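/- **Setting.** Let $(M,\omega)$ be a closed (compact, without boundary) symplectic manifold, and let $H:\mathbb R\times M\to\mathbb R$ be smooth with $H(t+1,x)=H(t,x)$; write $H_t=H(t,\cdot)$. For a function $h$ let $X_h$ be defined by $\omega(X_h,\cdot)=dh$. Let $\phi_s^t$ be the flow of $sX_{H_t}$ (so $\phi_s^0=\mathrm{id}$), and let $J^s_t$ ($s\in[0,1]$, $t\in\mathbb R/\mathbb Z$) be a smooth family of $\omega$-compatible almost complex structures on $M$, i.e. $\omega(\cdot,J^s_t\cdot)$ is a Riemannian metric. Let $\Sigma$ be one of $\Sigma_-=(-\infty,0]\times S^1$, $\Sigma_+=[0,\infty)\times S^1$, $\mathbb R\times S^1$ ($S^1=\mathbb R/\mathbb Z$), with coordinates $(\tau,t)$, the flat metric, and the orientation $d\tau\wedge dt$. Let $\rho:\mathbb R\to[0,1]$ be a smooth monotone cut-off function with values $0$ and $1$ on the two sides of the interval $[A,B]$, where $[A,B]=[-R_2,-R_1]$ on $\Sigma_-$ and $[A,B]=[R_1,R_2]$ on $\Sigma_+$ ($0<R_1<R_2$ arbitrary), and $[A,B]=[R_1,R_2]$ with $R_1<R_2$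 arbitrary on $\mathbb R\times S^1$. Either $\rho$ decreases from $1$ to $0$ or it increases from $0$ to $1$. Put $f_\tau=\phi^1_{\rho(\tau)}$. The deformed mapping cylinder $E\to\Sigma$ is the part over $\Sigma$ of the quotient of $\mathbb R\times\mathbb R\times M$ by $(\tau,t,x)\sim(\tau,t-1,f_\tau(x))$. It is trivialized by $[\tau,t,x]\mapsto(\tau,t,\phi^t_{\rho(\tau)}(x))\in\Sigma\times M$. In this trivialization put $H_\rho(\tau,t,x)=\rho(\tau)H(t,x)$, $X_\rho=X_{\rho(\tau)H_t}$ and $$\omega_E=\omega+d(H_\rho\,dt),\qquad \widetilde J(\alpha,\beta,\xi)=\bigl(-\beta,\ \alpha,\ J^{\rho(\tau)}_t(\xi-\beta X_\rho)+\alpha X_\rho\bigr).$$ Let $\Omega_\lambda=\omega_E+\lambda\,\omega_\Sigma$, where $\lambda\in\mathbb R$ and $\omega_\Sigma$ is an area form on $\Sigma$ of total area $1$, and put $\langle V,W\rangle=\tfrac12\bigl(\Omega_\lambda(V,\widetilde JW)+\Omega_\lambda(W,\widetilde JV)\bigr)$, $|V|^2=\langle V,V\rangle$ (a metric for large $\lambda$).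 Let $V=V^v+V^h$ be the splitting of a tangent vector of $E$ into a part tangent to the fibre and a part $\omega_E$-orthogonal to the fibre. For linear maps $A,B$ from $T\Sigma$ to $TE$ write $\langle A,B\rangle=\sum_i\langle A(e_i),B(e_i)\rangle$ with $(e_1,e_2)=(\partial_\tau,\partial_t)$, and $|A|^2=\langle A,A\rangle$. **Proposition.** Let $v:\Sigma\to E$ be a smooth $\widetilde J$-holomorphic section, and let $u:\Sigma\to M$ be its $M$-component in the trivialization. Then: 1. $\langle (Dv)^v(w),(Dv)^h(w')\rangle=0$ at every point of $\Sigma$, for all tangent vectors $w,w'$ of $\Sigma$ there. In particular $\langle (Dv)^v,(Dv)^h\rangle=0$. 2. $|(Dv)^v|^2\ge 0$. The functions $|(Dv)^h|^2$, $\langle (Dv)^v,(Dv)^h\rangle$ and $\rho'(\tau)H(t,u(\tau,t))$ are integrable over $\Sigma$, the negative parts of $v^*\Omega_\lambda$ and $v^*\omega_E$ (as densities with respect to $d\tau\wedge dt$) are integrable, and in $(-\infty,+\infty]$ $$\frac12\int|(Dv)^v|^2=\int v^*\Omega_\lambda-\frac12\int|(Dv)^h|^2-\int\langle (Dv)^v,(Dv)^h\rangle=\int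 v^*\omega_E-\int\rho'(\tau)H(t,u(\tau,t))\,dt\,d\tau .$$ 3. If $v$ has finite energy, i.e. $|Dv|^2$ is integrable, then all the integrals in 2 are finite, and $$\frac12\int|(Dv)^v|^2\le\int v^*\omega_E+\int_0^1\max_M H_t\,dt\quad\text{if }\rho'\le0,$$ $$\frac12\int|(Dv)^v|^2\le\int v^*\omega_E+\int_0^1\bigl(-\min_M H_t\bigr)\,dt\quad\text{if }\rho'\ge0 .$$ In particular this holds on $\Sigma_-$ for every choice of $0<R_1<R_2<\infty$. -/

import Mathlib

open Set MeasureTheory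
open scoped Manifold

noncomputable section

namespace DeformedCylinder

/-! ### Symplectic manifolds, Hamiltonian isotopies, almost complex structures -/

/-- A (smooth) symplectic form on a manifold `M` without boundary modelled on `E`:
a smooth, alternating, nondegenerate and closed field of bilinear forms on the tangent spaces. -/
structure SymplecticForm (E : Type*) [NormedAddCommGroup E] [NormedSpace ℝ E]
    (M : Type*) [TopologicalSpace M] [ChartedSpace E M] [IsManifold 𝓘(ℝ, E) (⊤ : ℕ∞) M] where
  form (x : M) : TangentSpace 𝓘(ℝ, E) x →L[ℝ] TangentSpace 𝓘(ℝ, E) x →L[ℝ] ℝ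
  alternating (x : M) (ξ : TangentSpace 𝓘(ℝ, E) x) : form x ξ ξ = 0
  nondegenerate (x : M) (ξ : TangentSpace 𝓘(ℝ, E) x) : (∀ η, form x ξ η = 0) → ξ = 0
  smooth : ContMDiff 𝓘(ℝ, E) (𝓘(ℝ, E).prod 𝓘(ℝ, E →L[ℝ] E →L[ℝ] ℝ)) (⊤ : ℕ∞)
    (fun x : M => Bundle.TotalSpace.mk' (E →L[ℝ] E →L[ℝ] ℝ)
      (E := fun x : M =>
        TangentSpace 𝓘(ℝ, E) x →L[ℝ] TangentSpace 𝓘(ℝ, E) x →L[ℝ] ℝ) x (form x))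
  /-- `dω = 0`, written in every preferred chart: with `ω_y(b, c)` the coordinate expression of
  `ω` at `y`, the cyclic sum of `D_a (ω_y(b, c))` vanishes. -/
  closed (x₀ : M) (y : E) (_ : y ∈ (extChartAt 𝓘(ℝ, E) x₀).target) (a b c : E) :
    let rep : E → E → E → ℝ := fun z a' b' =>
      form ((extChartAt 𝓘(ℝ, E) x₀).symm z)
        (mfderiv 𝓘(ℝ, E) 𝓘(ℝ, E) (extChartAt 𝓘(ℝ, E) x₀).symm z a')
        (mfderiv 𝓘(ℝ, E) 𝓘(ℝ, E) (extChartAt 𝓘(ℝ, E) x₀).symm z b')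
    fderiv ℝ (fun z => rep z b c) y a + fderiv ℝ (fun z => rep z c a) y b
      + fderiv ℝ (fun z => rep z a b) y c = 0

variable {E : Type*} [NormedAddCommGroup E] [NormedSpace ℝ E]
  {M : Type*} [TopologicalSpace M] [ChartedSpace E M] [IsManifold 𝓘(ℝ, E) (⊤ : ℕ∞) M]

/-- The vector `ξ` with `ω(ξ, η) = α(η)` for all `η`. -/
def SymplecticForm.sharp (ω : SymplecticForm E M) (x : M)
    (α : TangentSpace 𝓘(ℝ, E) x → ℝ) : TangentSpace 𝓘(ℝ, E) x :=
  Classical.epsilon fun ξ => ∀ η, ω.form x ξ η = α η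

theorem SymplecticForm.exists_sharp [FiniteDimensional ℝ E] (ω : SymplecticForm E M) (x : M)
    (α : TangentSpace 𝓘(ℝ, E) x →ₗ[ℝ] ℝ) : ∃ ξ, ∀ η, ω.form x ξ η = α η := by
  have : FiniteDimensional ℝ (TangentSpace 𝓘(ℝ, E) x) := inferInstanceAs (FiniteDimensional ℝ E)
  let L : TangentSpace 𝓘(ℝ, E) x →ₗ[ℝ] Module.Dual ℝ (TangentSpace 𝓘(ℝ, E) x) :=
    { toFun := fun ξ => (ω.form x ξ).toLinearMap
      map_add' := fun a b => by ext; simp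
      map_smul' := fun a b => by ext; simp }
  have hinj : Function.Injective L := by
    rw [← LinearMap.ker_eq_bot, LinearMap.ker_eq_bot']
    intro ξ hξ
    exact ω.nondegenerate x ξ fun η => LinearMap.congr_fun hξ η
  have hsurj : Function.Surjective L :=
    (LinearMap.injective_iff_surjective_of_finrank_eq_finrank
      (Subspace.dual_finrank_eq).symm).1 hinj
  obtain ⟨ξ, hξ⟩ := hsurj α
  exact ⟨ξ, fun η => LinearMap.congr_fun hξ η⟩

theorem SymplecticForm.sharp_spec [FiniteDimensional ℝ E] (ω : SymplecticForm E M) (x : M)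
    (α : TangentSpace 𝓘(ℝ, E) x →ₗ[ℝ] ℝ) (η : TangentSpace 𝓘(ℝ, E) x) :
    ω.form x (ω.sharp x α) η = α η :=
  Classical.epsilon_spec (ω.exists_sharp x α) η

/-- The Hamiltonian vector field `X_h` of a function `h`, with the sign convention
`ω(X_h, ·) = dh`. -/
def SymplecticForm.hamVF (ω : SymplecticForm E M) (h : M → ℝ) (x : M) : TangentSpace 𝓘(ℝ, E) x :=
  ω.sharp x fun η => mfderiv 𝓘(ℝ, E) 𝓘(ℝ, ℝ) h x η

/-- A smooth one-periodic time-dependent Hamiltonian `H(t, x) = H_t(x)`. -/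
structure PeriodicHamiltonian (E : Type*) [NormedAddCommGroup E] [NormedSpace ℝ E]
    (M : Type*) [TopologicalSpace M] [ChartedSpace E M] where
  toFun : ℝ → M → ℝ
  smooth : ContMDiff (𝓘(ℝ, ℝ).prod 𝓘(ℝ, E)) 𝓘(ℝ, ℝ) (⊤ : ℕ∞) fun p : ℝ × M => toFun p.1 p.2
  periodic (t : ℝ) (x : M) : toFun (t + 1) x = toFun t x

instance : CoeFun (PeriodicHamiltonian E M) fun _ => ℝ → M → ℝ := ⟨PeriodicHamiltonian.toFun⟩

/-- The two-parameter family `φ(s, t) = φ_s^t` of Hamiltonian diffeomorphisms generated by the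
linear homotopy `H(s, t, x) = s H(t, x)`: `φ_s^0 = id` and `∂φ_s^t/∂t = s X_{H_t} ∘ φ_s^t`.
The time parameter ranges over `ℝ`, through `φ_s^{t+1} = φ_s^t ∘ φ_s^1`. -/
structure HamiltonianIsotopy (ω : SymplecticForm E M) (H : PeriodicHamiltonian E M) where
  toFun : ℝ → ℝ → Diffeomorph 𝓘(ℝ, E) 𝓘(ℝ, E) M M (⊤ : ℕ∞)
  smooth : ContMDiff (𝓘(ℝ, ℝ).prod (𝓘(ℝ, ℝ).prod 𝓘(ℝ, E))) 𝓘(ℝ, E) (⊤ : ℕ∞)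
    fun p : ℝ × ℝ × M => toFun p.1 p.2.1 p.2.2
  zero (s : ℝ) (x : M) : toFun s 0 x = x
  flow (s t : ℝ) (x : M) : HasMFDerivAt 𝓘(ℝ, ℝ) 𝓘(ℝ, E) (fun t' => toFun s t' x) t
    (ContinuousLinearMap.toSpanSingleton ℝ (ω.hamVF (fun y => s * H t y) (toFun s t x)))
  add_one (s t : ℝ) (x : M) : toFun s (t + 1) x = toFun s t (toFun s 1 x)

/-- A smooth family `J^s_t`, `s ∈ [0,1]`, one-periodic in `t`, of almost complex structures
compatible with `ω`: `J² = -1`, and `ω(·, J·)` is a Riemannian metric. -/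
structure CompatibleFamily (ω : SymplecticForm E M) where
  toFun (s t : ℝ) (x : M) : TangentSpace 𝓘(ℝ, E) x →L[ℝ] TangentSpace 𝓘(ℝ, E) x
  smooth : ContMDiffOn (𝓘(ℝ, ℝ).prod (𝓘(ℝ, ℝ).prod 𝓘(ℝ, E)))
    (𝓘(ℝ, E).prod 𝓘(ℝ, E →L[ℝ] E)) (⊤ : ℕ∞)
    (fun p : ℝ × ℝ × M => Bundle.TotalSpace.mk' (E →L[ℝ] E)
      (E := fun x : M => TangentSpace 𝓘(ℝ, E) x →L[ℝ] TangentSpace 𝓘(ℝ, E) x)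
      p.2.2 (toFun p.1 p.2.1 p.2.2))
    {p | p.1 ∈ Icc (0 : ℝ) 1}
  periodic (s : ℝ) (_ : s ∈ Icc (0 : ℝ) 1) (t : ℝ) (x : M) : toFun s (t + 1) x = toFun s t x
  sq (s : ℝ) (_ : s ∈ Icc (0 : ℝ) 1) (t : ℝ) (x : M) (ξ : TangentSpace 𝓘(ℝ, E) x) :
    toFun s t x (toFun s t x ξ) = -ξ
  invariant (s : ℝ) (_ : s ∈ Icc (0 : ℝ) 1) (t : ℝ) (x : M) (ξ η : TangentSpace 𝓘(ℝ, E) x) :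
    ω.form x (toFun s t x ξ) (toFun s t x η) = ω.form x ξ η
  pos (s : ℝ) (_ : s ∈ Icc (0 : ℝ) 1) (t : ℝ) (x : M) (ξ : TangentSpace 𝓘(ℝ, E) x) :
    ξ ≠ 0 → 0 < ω.form x ξ (toFun s t x ξ)

/-! ### The base and the cut-off functions -/

/-- The three bases: `Σ₋ = (-∞,0] × S¹`, `Σ₊ = [0,∞) × S¹`, `Σ = ℝ × S¹`. -/
inductive Base where
  | neg
  | pos
  | full

namespace Base

/-- The range of the coordinate `τ`. -/
def domain : Base → Set ℝ
  | neg => Iic 0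
  | pos => Ici 0
  | full => univ

/-- The admissible pairs `R₁, R₂`. -/
def Radii : Base → ℝ → ℝ → Prop
  | neg, R₁, R₂ => 0 < R₁ ∧ R₁ < R₂
  | pos, R₁, R₂ => 0 < R₁ ∧ R₁ < R₂
  | full, R₁, R₂ => R₁ < R₂

/-- The left end of the interval where the cut-off function varies. -/
def left : Base → ℝ → ℝ → ℝ
  | neg, _, R₂ => -R₂
  | pos, R₁, _ => R₁
  | full, R₁, _ => R₁

/-- The right end of the interval where the cut-off function varies. -/
def right : Base → ℝ → ℝ → ℝ
  | neg, R₁, _ => -R₁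
  | pos, _, R₂ => R₂
  | full, _, R₂ => R₂

/-- The domain of `(τ, t)` in the universal cover of the base. -/
def cover (b : Base) : Set (ℝ × ℝ) := b.domain ×ˢ univ

/-- The measure `dτ dt` on the base, carried by the fundamental domain `0 < t ≤ 1`. -/
def measure (b : Base) : Measure (ℝ × ℝ) := volume.restrict (b.domain ×ˢ Ioc (0 : ℝ) 1)

end Base

/-- `ρ` is smooth, equals `1` for `τ ≤ A` and `0` for `τ ≥ B`, and `ρ' ≤ 0`. -/
structure IsDecreasingCutoff (A B : ℝ) (ρ : ℝ → ℝ) : Prop where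
  smooth : ContDiff ℝ (⊤ : ℕ∞) ρ
  eq_one (τ : ℝ) : τ ≤ A → ρ τ = 1
  eq_zero (τ : ℝ) : B ≤ τ → ρ τ = 0
  deriv_nonpos (τ : ℝ) : deriv ρ τ ≤ 0

/-- `ρ` is smooth, equals `0` for `τ ≤ A` and `1` for `τ ≥ B`, and `ρ' ≥ 0`. -/
structure IsIncreasingCutoff (A B : ℝ) (ρ : ℝ → ℝ) : Prop where
  smooth : ContDiff ℝ (⊤ : ℕ∞) ρ
  eq_zero (τ : ℝ) : τ ≤ A → ρ τ = 0
  eq_one (τ : ℝ) : B ≤ τ → ρ τ = 1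
  deriv_nonneg (τ : ℝ) : 0 ≤ deriv ρ τ

/-- An area form `ω_Σ = σ(τ, t) dτ ∧ dt` on the base, of total area one. -/
structure AreaForm (b : Base) where
  density : ℝ × ℝ → ℝ
  smooth : ContDiffOn ℝ (⊤ : ℕ∞) density b.cover
  periodic (τ t : ℝ) : τ ∈ b.domain → density (τ, t + 1) = density (τ, t)
  pos (p : ℝ × ℝ) : p ∈ b.cover → 0 < density p
  integrable : Integrable density b.measure
  total : ∫ p, density p ∂b.measure = 1

/-! ### The deformed mapping cylinder -/

/-- The relation `(τ, t, x) ∼ (τ, t - 1, f_τ(x))`. -/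
def CylinderRel (f : ℝ → M → M) (p q : ℝ × ℝ × M) : Prop :=
  q = (p.1, p.2.1 - 1, f p.1 p.2.2)

/-- The mapping cylinder `E_f = ℝ × ℝ × M / (τ, t, x) ∼ (τ, t - 1, f_τ(x))` of a path `f` of maps;
over a half-cylinder only its part over that half-cylinder is used. -/
def MappingCylinder (f : ℝ → M → M) : Type _ := Quot (CylinderRel f)

theorem coe_sub_one (t : ℝ) : ((t - 1 : ℝ) : AddCircle (1 : ℝ)) = (t : AddCircle (1 : ℝ)) := by
  have h := AddCircle.coe_add_period (1 : ℝ) (t - 1)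
  rw [sub_add_cancel] at h
  exact h.symm

/-- The projection `[τ, t, x] ↦ (τ, t)` to the cylinder `ℝ × S¹`, `S¹ = ℝ/ℤ`. -/
def MappingCylinder.proj {f : ℝ → M → M} : MappingCylinder f → ℝ × AddCircle (1 : ℝ) :=
  Quot.lift (fun p => (p.1, (p.2.1 : AddCircle (1 : ℝ)))) (by
    rintro p q rfl
    exact Prod.ext rfl (coe_sub_one _).symm)

variable {ω : SymplecticForm E M} {H : PeriodicHamiltonian E M}

/-- The path `f_τ = φ^1_{ρ(τ)}`. -/
def HamiltonianIsotopy.path (φ : HamiltonianIsotopy ω H) (ρ : ℝ → ℝ) (τ : ℝ) : M → M :=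
  φ.toFun (ρ τ) 1

theorem HamiltonianIsotopy.sub_one_path (φ : HamiltonianIsotopy ω H) (ρ : ℝ → ℝ) (τ t : ℝ)
    (x : M) : φ.toFun (ρ τ) (t - 1) (φ.path ρ τ x) = φ.toFun (ρ τ) t x := by
  have h := φ.add_one (ρ τ) (t - 1) x
  rw [sub_add_cancel] at h
  exact h.symm

/-- The fibre component `[τ, t, x] ↦ φ^t_{ρ(τ)}(x)` of the trivialization. -/
def fiberCoord (φ : HamiltonianIsotopy ω H) (ρ : ℝ → ℝ) : MappingCylinder (φ.path ρ) → M :=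
  Quot.lift (fun p => φ.toFun (ρ p.1) p.2.1 p.2.2) (by
    rintro p q rfl
    exact (φ.sub_one_path ρ p.1 p.2.1 p.2.2).symm)

/-- The trivialization `[τ, t, x] ↦ (τ, t, φ^t_{ρ(τ)}(x))` of the deformed mapping cylinder. Its
smooth structure, the form `ω_E` and the almost complex structure `J̃` are those making this
bijection an isomorphism; all of them are written in this trivialization below. -/
def trivialization (φ : HamiltonianIsotopy ω H) (ρ : ℝ → ℝ) (e : MappingCylinder (φ.path ρ)) :
    (ℝ × AddCircle (1 : ℝ)) × M :=
  (e.proj, fiberCoord φ ρ e)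

theorem exists_rep_nat {f : ℝ → M → M} (τ t : ℝ) (x : M) (n : ℕ) :
    (Quot.mk (CylinderRel f) (τ, t, x)) = Quot.mk (CylinderRel f) (τ, t - n, (f τ)^[n] x) := by
  induction n with
  | zero => simp
  | succ k ih =>
    rw [ih]
    apply Quot.sound
    simp only [CylinderRel, Function.iterate_succ_apply', Prod.mk.injEq, true_and, and_true]
    push_cast
    ring

theorem trivialization_bijective (φ : HamiltonianIsotopy ω H) (ρ : ℝ → ℝ) :
    Function.Bijective (trivialization φ ρ) := by
  have key : ∀ (τ t t' : ℝ) (x x' : M) (n : ℕ), t' = t - n →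
      φ.toFun (ρ τ) t x = φ.toFun (ρ τ) t' x' →
      Quot.mk (CylinderRel (φ.path ρ)) (τ, t, x) = Quot.mk (CylinderRel (φ.path ρ)) (τ, t', x') := by
    rintro τ t _ x x' n rfl hx
    have hq := exists_rep_nat (f := φ.path ρ) τ t x n
    have h : φ.toFun (ρ τ) t x = φ.toFun (ρ τ) (t - n) ((φ.path ρ τ)^[n] x) :=
      congrArg (fiberCoord φ ρ) hq
    rw [hx] at h
    rw [(φ.toFun (ρ τ) (t - n)).injective h]
    exact hq
  constructor
  · rintro ⟨τ, t, x⟩ ⟨τ', t', x'⟩ h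
    have h1 : τ = τ' := congrArg (fun z => z.1.1) h
    have h2 : (t : AddCircle (1 : ℝ)) = (t' : AddCircle (1 : ℝ)) := congrArg (fun z => z.1.2) h
    have h3 : φ.toFun (ρ τ) t x = φ.toFun (ρ τ') t' x' := congrArg (fun z => z.2) h
    subst h1
    rw [← sub_eq_zero, ← AddCircle.coe_sub, AddCircle.coe_eq_zero_iff] at h2
    obtain ⟨n, hn⟩ := h2
    rcases Int.eq_nat_or_neg n with ⟨k, rfl | rfl⟩
    · exact key τ t t' x x' k (by simp at hn; linarith) h3
    · exact (key τ t' t x' x k (by simp at hn; linarith) h3.symm).symm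
  · rintro ⟨⟨τ, θ⟩, y⟩
    obtain ⟨t, rfl⟩ := QuotientAddGroup.mk_surjective θ
    refine ⟨Quot.mk _ (τ, t, (φ.toFun (ρ τ) t).symm y), ?_⟩
    refine Prod.ext rfl ?_
    exact (φ.toFun (ρ τ) t).apply_symm_apply y

/-- The map `u(τ, t)` which represents a map `v` into `E_f` in the trivialization. -/
def coordMap (φ : HamiltonianIsotopy ω H) (ρ : ℝ → ℝ)
    (v : ℝ × AddCircle (1 : ℝ) → MappingCylinder (φ.path ρ)) (p : ℝ × ℝ) : M :=
  fiberCoord φ ρ (v (p.1, (p.2 : AddCircle (1 : ℝ))))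

/-- `v` is a smooth section of `E_f` over the base `b` (its values elsewhere are irrelevant). -/
structure IsSmoothSection (φ : HamiltonianIsotopy ω H) (ρ : ℝ → ℝ) (b : Base)
    (v : ℝ × AddCircle (1 : ℝ) → MappingCylinder (φ.path ρ)) : Prop where
  proj_eq (z : ℝ × AddCircle (1 : ℝ)) : z.1 ∈ b.domain → (v z).proj = z
  smooth : ContMDiffOn 𝓘(ℝ, ℝ × ℝ) 𝓘(ℝ, E) (⊤ : ℕ∞) (coordMap φ ρ v) b.cover

/-! ### The form `ω_E`, its connection, `J̃` and the associated metric, in the trivialization -/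

/-- The tangent space of the total space at a point `(τ, t, x)`: vectors
`(α, β, ξ) = α ∂/∂τ + β ∂/∂t + ξ`. -/
abbrev TotalTangent (E : Type*) [NormedAddCommGroup E] [NormedSpace ℝ E]
    {M : Type*} [TopologicalSpace M] [ChartedSpace E M] (x : M) : Type _ :=
  ℝ × ℝ × TangentSpace 𝓘(ℝ, E) x

/-- The differential of the function `H_ρ(τ, t, x) = ρ(τ) H(t, x)` on the total space. -/
def dHρ (H : PeriodicHamiltonian E M) (ρ : ℝ → ℝ) (p : ℝ × ℝ × M)
    (V : TotalTangent E p.2.2) : ℝ :=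
  mfderiv (𝓘(ℝ, ℝ).prod (𝓘(ℝ, ℝ).prod 𝓘(ℝ, E))) 𝓘(ℝ, ℝ)
    (fun q : ℝ × ℝ × M => ρ q.1 * H q.2.1 q.2.2) p V

/-- The form `ω_E = ω + d(H_ρ dt) = ω + dH_ρ ∧ dt`. -/
def omegaE (ω : SymplecticForm E M) (H : PeriodicHamiltonian E M) (ρ : ℝ → ℝ) (p : ℝ × ℝ × M)
    (V W : TotalTangent E p.2.2) : ℝ :=
  ω.form p.2.2 V.2.2 W.2.2 + (dHρ H ρ p V * W.2.1 - dHρ H ρ p W * V.2.1)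

/-- The form `Ω_λ = ω_E + λ ω_Σ`. -/
def omegaLam (ω : SymplecticForm E M) (H : PeriodicHamiltonian E M) (ρ : ℝ → ℝ) {b : Base}
    (σ : AreaForm b) (lam : ℝ) (p : ℝ × ℝ × M) (V W : TotalTangent E p.2.2) : ℝ :=
  omegaE ω H ρ p V W + lam * (σ.density (p.1, p.2.1) * (V.1 * W.2.1 - V.2.1 * W.1))

/-- The vertical part `V^v` of a tangent vector `V` for the connection defined by `ω_E`: the
vertical vector for which `V - V^v` is `ω_E`-orthogonal to the fibre. -/
def vertPart (ω : SymplecticForm E M) (H : PeriodicHamiltonian E M) (ρ : ℝ → ℝ) (p : ℝ × ℝ × M)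
    (V : TotalTangent E p.2.2) : TotalTangent E p.2.2 :=
  (0, 0, Classical.epsilon fun ξ : TangentSpace 𝓘(ℝ, E) p.2.2 =>
    ∀ η : TangentSpace 𝓘(ℝ, E) p.2.2, omegaE ω H ρ p (V - (0, 0, ξ)) (0, 0, η) = 0)

/-- The horizontal part `V^h = V - V^v`. -/
def horPart (ω : SymplecticForm E M) (H : PeriodicHamiltonian E M) (ρ : ℝ → ℝ) (p : ℝ × ℝ × M)
    (V : TotalTangent E p.2.2) : TotalTangent E p.2.2 :=
  V - vertPart ω H ρ p V

theorem dHρ_add (H : PeriodicHamiltonian E M) (ρ : ℝ → ℝ) (p : ℝ × ℝ × M)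
    (V W : TotalTangent E p.2.2) : dHρ H ρ p (V + W) = dHρ H ρ p V + dHρ H ρ p W :=
  map_add (mfderiv (𝓘(ℝ, ℝ).prod (𝓘(ℝ, ℝ).prod 𝓘(ℝ, E))) 𝓘(ℝ, ℝ)
    (fun q : ℝ × ℝ × M => ρ q.1 * H q.2.1 q.2.2) p) V W

theorem dHρ_smul (H : PeriodicHamiltonian E M) (ρ : ℝ → ℝ) (p : ℝ × ℝ × M) (c : ℝ)
    (V : TotalTangent E p.2.2) : dHρ H ρ p (c • V) = c * dHρ H ρ p V :=
  map_smul (mfderiv (𝓘(ℝ, ℝ).prod (𝓘(ℝ, ℝ).prod 𝓘(ℝ, E))) 𝓘(ℝ, ℝ)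
    (fun q : ℝ × ℝ × M => ρ q.1 * H q.2.1 q.2.2) p) c V

/-- The vertical part exists and is unique. -/
theorem existsUnique_vertPart [FiniteDimensional ℝ E] (ω : SymplecticForm E M)
    (H : PeriodicHamiltonian E M) (ρ : ℝ → ℝ) (p : ℝ × ℝ × M) (V : TotalTangent E p.2.2) :
    ∃! ξ : TangentSpace 𝓘(ℝ, E) p.2.2,
      ∀ η : TangentSpace 𝓘(ℝ, E) p.2.2, omegaE ω H ρ p (V - (0, 0, ξ)) (0, 0, η) = 0 := by
  let α : TangentSpace 𝓘(ℝ, E) p.2.2 →ₗ[ℝ] ℝ :=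
    { toFun := fun η => ω.form p.2.2 V.2.2 η - dHρ H ρ p ((0, 0, η) : TotalTangent E p.2.2) * V.2.1
      map_add' := fun a b => by
        have := dHρ_add H ρ p ((0, 0, a) : TotalTangent E p.2.2) (0, 0, b)
        simp only [Prod.mk_add_mk, add_zero] at this
        rw [this, map_add]; ring
      map_smul' := fun c a => by
        have := dHρ_smul H ρ p c ((0, 0, a) : TotalTangent E p.2.2)
        simp only [Prod.smul_mk, smul_zero] at this
        rw [this, map_smul]; simp; ring }
  have hiff : ∀ ξ η : TangentSpace 𝓘(ℝ, E) p.2.2,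
      omegaE ω H ρ p (V - (0, 0, ξ)) (0, 0, η) = α η - ω.form p.2.2 ξ η := by
    intro ξ η
    simp [omegaE, α]
    ring
  obtain ⟨ξ, hξ⟩ := ω.exists_sharp p.2.2 α
  refine ⟨ξ, fun η => by rw [hiff, hξ, sub_self], fun ξ' h' => ?_⟩
  rw [← sub_eq_zero]
  refine ω.nondegenerate p.2.2 _ fun η => ?_
  have h1 := h' η
  rw [hiff] at h1
  rw [map_sub, sub_apply, hξ]
  linarith

/-- The vector field `X_ρ` generated by `H_ρ`. -/
def Xρ (ω : SymplecticForm E M) (H : PeriodicHamiltonian E M) (ρ : ℝ → ℝ) (p : ℝ × ℝ × M) :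
    TangentSpace 𝓘(ℝ, E) p.2.2 :=
  ω.hamVF (fun y => ρ p.1 * H p.2.1 y) p.2.2

/-- The almost complex structure
`J̃(α, β, ξ) = (-β, α, J^{ρ(τ)}_t (ξ - β X_ρ) + α X_ρ)` on the total space. -/
def Jtilde (H : PeriodicHamiltonian E M) (ρ : ℝ → ℝ) (J : CompatibleFamily ω) (p : ℝ × ℝ × M)
    (V : TotalTangent E p.2.2) : TotalTangent E p.2.2 :=
  (-V.2.1, V.1, J.toFun (ρ p.1) p.2.1 p.2.2 (V.2.2 - V.2.1 • Xρ ω H ρ p) + V.1 • Xρ ω H ρ p)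

/-- The associated bilinear form `⟨V, W⟩ = (Ω_λ(V, J̃ W) + Ω_λ(W, J̃ V)) / 2`. -/
def gtilde (H : PeriodicHamiltonian E M) (ρ : ℝ → ℝ) (J : CompatibleFamily ω) {b : Base}
    (σ : AreaForm b) (lam : ℝ) (p : ℝ × ℝ × M) (V W : TotalTangent E p.2.2) : ℝ :=
  (1 / 2) * (omegaLam ω H ρ σ lam p V (Jtilde H ρ J p W)
    + omegaLam ω H ρ σ lam p W (Jtilde H ρ J p V))

/-! ### Sections, their derivatives and energies

In what follows `u` is the map representing a section in the trivialization. -/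

/-- The point `(τ, t, u(τ, t))` of the section over `(τ, t)`. -/
def graphPt (u : ℝ × ℝ → M) (z : ℝ × ℝ) : ℝ × ℝ × M := (z.1, z.2, u z)

/-- The derivative `Dv(w) = (α, β, du(w))` of the section in the direction
`w = α ∂/∂τ + β ∂/∂t` (one-sided at the boundary of the base). -/
def Dv (E : Type*) [NormedAddCommGroup E] [NormedSpace ℝ E]
    {M : Type*} [TopologicalSpace M] [ChartedSpace E M]
    (b : Base) (u : ℝ × ℝ → M) (z w : ℝ × ℝ) : TotalTangent E (graphPt u z).2.2 :=
  (w.1, w.2, mfderivWithin 𝓘(ℝ, ℝ × ℝ) 𝓘(ℝ, E) u b.cover z w)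

/-- The section is `J̃`-holomorphic: `Dv ∘ j = J̃ ∘ Dv`, where `j ∂/∂τ = ∂/∂t`. -/
def IsHolomorphic (H : PeriodicHamiltonian E M) (ρ : ℝ → ℝ) (J : CompatibleFamily ω) (b : Base)
    (u : ℝ × ℝ → M) : Prop :=
  ∀ z ∈ b.cover, ∀ w : ℝ × ℝ,
    Dv E b u z (-w.2, w.1) = Jtilde H ρ J (graphPt u z) (Dv E b u z w)

/-- The density of `v^*ω_E` with respect to `dτ ∧ dt`. -/
def pullOmegaE (ω : SymplecticForm E M) (H : PeriodicHamiltonian E M) (ρ : ℝ → ℝ) (b : Base)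
    (u : ℝ × ℝ → M) (z : ℝ × ℝ) : ℝ :=
  omegaE ω H ρ (graphPt u z) (Dv E b u z (1, 0)) (Dv E b u z (0, 1))

/-- The density of `v^*Ω_λ` with respect to `dτ ∧ dt`. -/
def pullOmegaLam (ω : SymplecticForm E M) (H : PeriodicHamiltonian E M) (ρ : ℝ → ℝ) {b : Base}
    (σ : AreaForm b) (lam : ℝ) (u : ℝ × ℝ → M) (z : ℝ × ℝ) : ℝ :=
  omegaLam ω H ρ σ lam (graphPt u z) (Dv E b u z (1, 0)) (Dv E b u z (0, 1))

/-- The pairing `⟨A, B⟩ = ∑ ⟨A(e_i), B(e_i)⟩` of two linear maps from the tangent space of the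
base to that of the total space, for the orthonormal frame `∂/∂τ, ∂/∂t` of the flat metric. -/
def pairing (H : PeriodicHamiltonian E M) (ρ : ℝ → ℝ) (J : CompatibleFamily ω) {b : Base}
    (σ : AreaForm b) (lam : ℝ) (p : ℝ × ℝ × M) (A B : ℝ × ℝ → TotalTangent E p.2.2) : ℝ :=
  gtilde H ρ J σ lam p (A (1, 0)) (B (1, 0)) + gtilde H ρ J σ lam p (A (0, 1)) (B (0, 1))

/-- `(Dv)^v`. -/
def DvVert (ω : SymplecticForm E M) (H : PeriodicHamiltonian E M) (ρ : ℝ → ℝ) (b : Base)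
    (u : ℝ × ℝ → M) (z w : ℝ × ℝ) : TotalTangent E (graphPt u z).2.2 :=
  vertPart ω H ρ (graphPt u z) (Dv E b u z w)

/-- `(Dv)^h`. -/
def DvHor (ω : SymplecticForm E M) (H : PeriodicHamiltonian E M) (ρ : ℝ → ℝ) (b : Base)
    (u : ℝ × ℝ → M) (z w : ℝ × ℝ) : TotalTangent E (graphPt u z).2.2 :=
  horPart ω H ρ (graphPt u z) (Dv E b u z w)

/-- The energy density `|Dv|²`. -/
def energyDensity (H : PeriodicHamiltonian E M) (ρ : ℝ → ℝ) (J : CompatibleFamily ω) {b : Base}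
    (σ : AreaForm b) (lam : ℝ) (u : ℝ × ℝ → M) (z : ℝ × ℝ) : ℝ :=
  pairing H ρ J σ lam (graphPt u z) (Dv E b u z) (Dv E b u z)

/-- The vertical energy density `|(Dv)^v|²`. -/
def vertDensity (H : PeriodicHamiltonian E M) (ρ : ℝ → ℝ) (J : CompatibleFamily ω) {b : Base}
    (σ : AreaForm b) (lam : ℝ) (u : ℝ × ℝ → M) (z : ℝ × ℝ) : ℝ :=
  pairing H ρ J σ lam (graphPt u z) (DvVert ω H ρ b u z) (DvVert ω H ρ b u z)

/-- The horizontal energy density `|(Dv)^h|²`. -/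
def horDensity (H : PeriodicHamiltonian E M) (ρ : ℝ → ℝ) (J : CompatibleFamily ω) {b : Base}
    (σ : AreaForm b) (lam : ℝ) (u : ℝ × ℝ → M) (z : ℝ × ℝ) : ℝ :=
  pairing H ρ J σ lam (graphPt u z) (DvHor ω H ρ b u z) (DvHor ω H ρ b u z)

/-- The mixed term `⟨(Dv)^v, (Dv)^h⟩`. -/
def crossDensity (H : PeriodicHamiltonian E M) (ρ : ℝ → ℝ) (J : CompatibleFamily ω) {b : Base}
    (σ : AreaForm b) (lam : ℝ) (u : ℝ × ℝ → M) (z : ℝ × ℝ) : ℝ :=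
  pairing H ρ J σ lam (graphPt u z) (DvVert ω H ρ b u z) (DvHor ω H ρ b u z)

/-- The function `ρ'(τ) H(t, u(τ, t))`. -/
def curvatureTerm (H : PeriodicHamiltonian E M) (ρ : ℝ → ℝ) (u : ℝ × ℝ → M) (z : ℝ × ℝ) : ℝ :=
  deriv ρ z.1 * H z.2 (u z)

/-- `f` is measurable with integrable negative part, so that `∫ f ∈ (-∞, +∞]` is defined. -/
def QuasiIntegrable (f : ℝ × ℝ → ℝ) (μ : Measure (ℝ × ℝ)) : Prop :=
  AEMeasurable f μ ∧ ∫⁻ z, ENNReal.ofReal (-f z) ∂μ ≠ ⊤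

/-- The integral `∫ f⁺ - ∫ f⁻` with values in `[-∞, +∞]`. -/
def extIntegral (f : ℝ × ℝ → ℝ) (μ : Measure (ℝ × ℝ)) : EReal :=
  ((∫⁻ z, ENNReal.ofReal (f z) ∂μ : ENNReal) : EReal)
    - ((∫⁻ z, ENNReal.ofReal (-f z) ∂μ : ENNReal) : EReal)

end DeformedCylinder

end

/-! Everything is a pointwise computation in the trivialization, followed by integration. On the
fibres `dH_ρ = ω(X_ρ, ·)`, while `dH_ρ(∂_τ) = ρ' H`. Hence the horizontal lift of `α ∂_τ + β ∂_t` is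
`(α, β, β X_ρ)`, and the vertical part of `(α, β, ξ)` is `ξ - β X_ρ` (`vertPart_eq`, `horPart_eq`).
`J̃` preserves both subspaces: it is `J` on vertical vectors and the rotation of the base on
horizontal ones. `Ω_λ` pairs the two subspaces to zero, so they are orthogonal for the metric.

Put `a = ω(∂_τ u, ∂_t u - X_ρ)` (`fiberArea`). Holomorphy reads `∂_t u - X_ρ = J ∂_τ u`, so
compatibility gives `a ≥ 0` and `|(Dv)^v|² = 2a`. With or without holomorphy, `v^*ω_E = a + ρ' H`,
`v^*Ω_λ = a + ρ' H + λσ` and `|(Dv)^h|² = 2(ρ' H + λσ)`. Both energy formulas are therefore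
instances of `½∫2a = ∫(a + g) - ∫g` with `g` integrable (`half_extIntegral_eq`): for real values
this is additivity, and if `a` is not integrable both sides are `+∞`. The term `ρ' H` is integrable
because `ρ'` vanishes off `[A, B]`, which lies in the base, and `t` runs over a bounded period.

For finite energy, `|Dv|² = 2 v^*Ω_λ` makes `a` integrable. The sign of `ρ'` bounds `ρ' H(t, u)`
below by `ρ' max H_t` or `ρ' min H_t`; Fubini and `∫ρ' = ∓1` turn this into the stated estimates. -/

noncomputable section

namespace DeformedCylinder

/-! ### Pointwise linear algebra of the connection, `J̃` and the metric. -/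

section Algebra

variable {E : Type*} [NormedAddCommGroup E] [NormedSpace ℝ E]
  {M : Type*} [TopologicalSpace M] [ChartedSpace E M]

theorem PeriodicHamiltonian.mdifferentiableAt (H : PeriodicHamiltonian E M) (p : ℝ × M) :
    MDifferentiableAt (𝓘(ℝ, ℝ).prod 𝓘(ℝ, E)) 𝓘(ℝ, ℝ) (fun q : ℝ × M => H.toFun q.1 q.2) p :=
  H.smooth.mdifferentiable (by simp) p

theorem mdifferentiableAt_cutoff_mul (H : PeriodicHamiltonian E M) {ρ : ℝ → ℝ}
    (hρ : Differentiable ℝ ρ) (p : ℝ × ℝ × M) :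
    MDifferentiableAt (𝓘(ℝ, ℝ).prod (𝓘(ℝ, ℝ).prod 𝓘(ℝ, E))) 𝓘(ℝ, ℝ)
      (fun q : ℝ × ℝ × M => ρ q.1 * H.toFun q.2.1 q.2.2) p := by
  have h1 : MDifferentiableAt (𝓘(ℝ, ℝ).prod (𝓘(ℝ, ℝ).prod 𝓘(ℝ, E))) 𝓘(ℝ, ℝ)
      (fun q : ℝ × ℝ × M => ρ q.1) p :=
    (hρ p.1).mdifferentiableAt.comp p mdifferentiableAt_fst
  have h2 : MDifferentiableAt (𝓘(ℝ, ℝ).prod (𝓘(ℝ, ℝ).prod 𝓘(ℝ, E))) 𝓘(ℝ, ℝ)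
      (fun q : ℝ × ℝ × M => H.toFun q.2.1 q.2.2) p :=
    (H.mdifferentiableAt p.2).comp p mdifferentiableAt_snd
  exact h1.mul h2

theorem dHρ_eq_mfderiv_fiber (H : PeriodicHamiltonian E M) {ρ : ℝ → ℝ}
    (hρ : Differentiable ℝ ρ) (p : ℝ × ℝ × M) (η : TangentSpace 𝓘(ℝ, E) p.2.2) :
    dHρ H ρ p ((0, 0, η) : TotalTangent E p.2.2) =
      mfderiv 𝓘(ℝ, E) 𝓘(ℝ, ℝ) (fun y => ρ p.1 * H.toFun p.2.1 y) p.2.2 η := by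
  have hi : HasMFDerivAt 𝓘(ℝ, E) (𝓘(ℝ, ℝ).prod (𝓘(ℝ, ℝ).prod 𝓘(ℝ, E)))
      (fun y : M => (p.1, p.2.1, y)) p.2.2 _ :=
    (hasMFDerivAt_const p.1 p.2.2).prodMk
      ((hasMFDerivAt_const p.2.1 p.2.2).prodMk (hasMFDerivAt_id p.2.2))
  have h := ((mdifferentiableAt_cutoff_mul H hρ p).hasMFDerivAt.comp p.2.2 hi).mfderiv
  exact (DFunLike.congr_fun h η).symm

theorem dHρ_tau (H : PeriodicHamiltonian E M) {ρ : ℝ → ℝ}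
    (hρ : Differentiable ℝ ρ) (p : ℝ × ℝ × M) :
    dHρ H ρ p ((1, 0, 0) : TotalTangent E p.2.2) = deriv ρ p.1 * H.toFun p.2.1 p.2.2 := by
  have hi : HasMFDerivAt 𝓘(ℝ, ℝ) (𝓘(ℝ, ℝ).prod (𝓘(ℝ, ℝ).prod 𝓘(ℝ, E)))
      (fun s : ℝ => (s, p.2.1, p.2.2)) p.1 _ :=
    (hasMFDerivAt_id p.1).prodMk
      ((hasMFDerivAt_const p.2.1 p.1).prodMk (hasMFDerivAt_const p.2.2 p.1))
  have h := ((mdifferentiableAt_cutoff_mul H hρ p).hasMFDerivAt.comp p.1 hi)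
  have h' : HasMFDerivAt 𝓘(ℝ, ℝ) 𝓘(ℝ, ℝ) (fun s => ρ s * H.toFun p.2.1 p.2.2) p.1 _ :=
    ((hρ p.1).hasDerivAt.mul_const (H.toFun p.2.1 p.2.2)).hasFDerivAt.hasMFDerivAt
  have e := DFunLike.congr_fun (hasMFDerivAt_unique h h') (1 : ℝ)
  have key (c : ℝ) : ContinuousLinearMap.toSpanSingleton ℝ c 1 = c := by simp
  exact e.trans (key _)

variable [FiniteDimensional ℝ E] [IsManifold 𝓘(ℝ, E) (⊤ : ℕ∞) M]
  {ω : SymplecticForm E M}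

theorem SymplecticForm.form_hamVF (ω : SymplecticForm E M) (h : M → ℝ) (x : M)
    (η : TangentSpace 𝓘(ℝ, E) x) :
    ω.form x (ω.hamVF h x) η = mfderiv 𝓘(ℝ, E) 𝓘(ℝ, ℝ) h x η :=
  ω.sharp_spec x (mfderiv 𝓘(ℝ, E) 𝓘(ℝ, ℝ) h x).toLinearMap η

omit [FiniteDimensional ℝ E] in
theorem SymplecticForm.form_swap (ω : SymplecticForm E M) (x : M)
    (ξ η : TangentSpace 𝓘(ℝ, E) x) : ω.form x ξ η = -ω.form x η ξ := by
  have h := ω.alternating x (ξ + η)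
  simp only [map_add, add_apply, ω.alternating] at h
  linarith

theorem dHρ_fiber (H : PeriodicHamiltonian E M) {ρ : ℝ → ℝ}
    (hρ : Differentiable ℝ ρ) (p : ℝ × ℝ × M) (η : TangentSpace 𝓘(ℝ, E) p.2.2) :
    dHρ H ρ p ((0, 0, η) : TotalTangent E p.2.2) = ω.form p.2.2 (Xρ ω H ρ p) η := by
  rw [dHρ_eq_mfderiv_fiber H hρ, Xρ, ω.form_hamVF]

/-- The `∂_t` component is left unevaluated: it cancels in the horizontal norm and drops out of the
pullback of `ω_E`. -/
theorem dHρ_apply (H : PeriodicHamiltonian E M) {ρ : ℝ → ℝ}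
    (hρ : Differentiable ℝ ρ) (p : ℝ × ℝ × M) (V : TotalTangent E p.2.2) :
    dHρ H ρ p V = V.1 * (deriv ρ p.1 * H.toFun p.2.1 p.2.2)
      + V.2.1 * dHρ H ρ p ((0, 1, 0) : TotalTangent E p.2.2)
      + ω.form p.2.2 (Xρ ω H ρ p) V.2.2 := by
  rw [← dHρ_tau H hρ, ← dHρ_fiber H hρ, ← dHρ_smul, ← dHρ_smul, ← dHρ_add, ← dHρ_add]
  congr 1
  obtain ⟨a, c, ξ⟩ := V
  simp

/-- The fibre component of the vertical part. -/
theorem vertPart_eq (ω : SymplecticForm E M) (H : PeriodicHamiltonian E M) {ρ : ℝ → ℝ}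
    (hρ : Differentiable ℝ ρ) (p : ℝ × ℝ × M) (V : TotalTangent E p.2.2) :
    vertPart ω H ρ p V = (0, 0, V.2.2 - V.2.1 • Xρ ω H ρ p) := by
  have hex := existsUnique_vertPart ω H ρ p V
  -- The vertical part is a choice; uniqueness identifies it with any candidate satisfying the same
  -- orthogonality condition, here `ξ - β X_ρ`.
  have hspec := Classical.epsilon_spec hex.exists
  have : ∀ η : TangentSpace 𝓘(ℝ, E) p.2.2,
      omegaE ω H ρ p (V - (0, 0, V.2.2 - V.2.1 • Xρ ω H ρ p)) (0, 0, η) = 0 := by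
    intro η
    simp only [omegaE, dHρ_fiber (ω := ω) H hρ]
    simp [mul_comm]
  unfold vertPart
  rw [hex.unique hspec this]

theorem horPart_eq (ω : SymplecticForm E M) (H : PeriodicHamiltonian E M) {ρ : ℝ → ℝ}
    (hρ : Differentiable ℝ ρ) (p : ℝ × ℝ × M) (V : TotalTangent E p.2.2) :
    horPart ω H ρ p V = (V.1, V.2.1, V.2.1 • Xρ ω H ρ p) := by
  rw [horPart, vertPart_eq ω H hρ]
  obtain ⟨a, c, ξ⟩ := V
  simp

/-- Vertical vectors are `ω_E`-orthogonal to horizontal ones. -/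
theorem omegaE_vert_hor (H : PeriodicHamiltonian E M) {ρ : ℝ → ℝ}
    (hρ : Differentiable ℝ ρ) (p : ℝ × ℝ × M) (ξ : TangentSpace 𝓘(ℝ, E) p.2.2) (a c : ℝ) :
    omegaE ω H ρ p (0, 0, ξ) (a, c, c • Xρ ω H ρ p) = 0 := by
  simp only [omegaE, dHρ_fiber (ω := ω) H hρ]
  rw [map_smul, ω.form_swap]
  simp
  ring

theorem omegaE_hor_vert (H : PeriodicHamiltonian E M) {ρ : ℝ → ℝ}
    (hρ : Differentiable ℝ ρ) (p : ℝ × ℝ × M) (ξ : TangentSpace 𝓘(ℝ, E) p.2.2) (a c : ℝ) :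
    omegaE ω H ρ p (a, c, c • Xρ ω H ρ p) (0, 0, ξ) = 0 := by
  simp only [omegaE, dHρ_fiber (ω := ω) H hρ]
  simp [mul_comm]

omit [FiniteDimensional ℝ E] in
theorem Jtilde_vert (H : PeriodicHamiltonian E M) (ρ : ℝ → ℝ) (J : CompatibleFamily ω)
    (p : ℝ × ℝ × M) (ξ : TangentSpace 𝓘(ℝ, E) p.2.2) :
    Jtilde H ρ J p (0, 0, ξ) = (0, 0, J.toFun (ρ p.1) p.2.1 p.2.2 ξ) := by
  simp [Jtilde]

omit [FiniteDimensional ℝ E] in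
-- For a horizontal vector `ξ - β X_ρ = 0`, so the term with `J` vanishes and only the rotation of
-- the base, lifted horizontally, remains.
theorem Jtilde_hor (H : PeriodicHamiltonian E M) (ρ : ℝ → ℝ) (J : CompatibleFamily ω)
    (p : ℝ × ℝ × M) (a c : ℝ) :
    Jtilde H ρ J p (a, c, c • Xρ ω H ρ p) = (-c, a, a • Xρ ω H ρ p) := by
  simp [Jtilde]

variable {b : Base} (σ : AreaForm b) (lam : ℝ)

/-- `J̃` preserves the vertical and the horizontal subspace, which are `ω_E`-orthogonal, and `ω_Σ`
vanishes when one argument is vertical. -/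
theorem gtilde_vert_hor (H : PeriodicHamiltonian E M) {ρ : ℝ → ℝ}
    (hρ : Differentiable ℝ ρ) (J : CompatibleFamily ω) (p : ℝ × ℝ × M)
    (ξ : TangentSpace 𝓘(ℝ, E) p.2.2) (a c : ℝ) :
    gtilde H ρ J σ lam p (0, 0, ξ) (a, c, c • Xρ ω H ρ p) = 0 := by
  simp only [gtilde, omegaLam, Jtilde_vert, Jtilde_hor, omegaE_vert_hor H hρ,
    omegaE_hor_vert H hρ]
  simp

omit [FiniteDimensional ℝ E] in
theorem gtilde_vert (H : PeriodicHamiltonian E M) (ρ : ℝ → ℝ) (J : CompatibleFamily ω)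
    (p : ℝ × ℝ × M) (ξ : TangentSpace 𝓘(ℝ, E) p.2.2) :
    gtilde H ρ J σ lam p (0, 0, ξ) (0, 0, ξ) =
      ω.form p.2.2 ξ (J.toFun (ρ p.1) p.2.1 p.2.2 ξ) := by
  simp only [gtilde, omegaLam, Jtilde_vert, omegaE]
  simp
  ring

/-- `ω` vanishes on multiples of `X_ρ`, so only `dH_ρ ∧ dt` and `λ ω_Σ` contribute; in the former
the `∂_t` derivatives cancel and the curvature `ρ' H` remains. -/
theorem gtilde_hor (H : PeriodicHamiltonian E M) {ρ : ℝ → ℝ}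
    (hρ : Differentiable ℝ ρ) (J : CompatibleFamily ω) (p : ℝ × ℝ × M) (a c : ℝ) :
    gtilde H ρ J σ lam p (a, c, c • Xρ ω H ρ p) (a, c, c • Xρ ω H ρ p) =
      (a ^ 2 + c ^ 2) * (deriv ρ p.1 * H.toFun p.2.1 p.2.2 + lam * σ.density (p.1, p.2.1)) := by
  simp only [gtilde, omegaLam, Jtilde_hor, omegaE]
  rw [dHρ_apply (ω := ω) H hρ p (a, c, c • Xρ ω H ρ p),
    dHρ_apply (ω := ω) H hρ p (-c, a, a • Xρ ω H ρ p)]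
  simp [ω.alternating]
  ring

theorem DvVert_eq (H : PeriodicHamiltonian E M) {ρ : ℝ → ℝ} (hρ : Differentiable ℝ ρ)
    (u : ℝ × ℝ → M) (z w : ℝ × ℝ) :
    DvVert ω H ρ b u z w = 
      (0, 0, (Dv E b u z w).2.2 - w.2 • Xρ ω H ρ (graphPt u z)) :=
  vertPart_eq ω H hρ _ _

theorem DvHor_eq (H : PeriodicHamiltonian E M) {ρ : ℝ → ℝ} (hρ : Differentiable ℝ ρ)
    (u : ℝ × ℝ → M) (z w : ℝ × ℝ) :
    DvHor ω H ρ b u z w = (w.1, w.2, w.2 • Xρ ω H ρ (graphPt u z)) :=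
  horPart_eq ω H hρ _ _

theorem gtilde_DvVert_DvHor (H : PeriodicHamiltonian E M) {ρ : ℝ → ℝ} (hρ : Differentiable ℝ ρ)
    (J : CompatibleFamily ω) (u : ℝ × ℝ → M) (z w w' : ℝ × ℝ) :
    gtilde H ρ J σ lam (graphPt u z) (DvVert ω H ρ b u z w) (DvHor ω H ρ b u z w') = 0 := by
  rw [DvVert_eq H hρ, DvHor_eq H hρ, gtilde_vert_hor σ lam H hρ]

theorem crossDensity_eq_zero (H : PeriodicHamiltonian E M) {ρ : ℝ → ℝ}
    (hρ : Differentiable ℝ ρ) (J : CompatibleFamily ω) (u : ℝ × ℝ → M) (z : ℝ × ℝ) :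
    crossDensity H ρ J σ lam u z = 0 := by
  rw [crossDensity, pairing, gtilde_DvVert_DvHor σ lam H hρ, gtilde_DvVert_DvHor σ lam H hρ,
    add_zero]

theorem horDensity_eq (H : PeriodicHamiltonian E M) {ρ : ℝ → ℝ}
    (hρ : Differentiable ℝ ρ) (J : CompatibleFamily ω) (u : ℝ × ℝ → M) (z : ℝ × ℝ) :
    horDensity H ρ J σ lam u z = 2 * (curvatureTerm H ρ u z + lam * σ.density z) := by
  rw [horDensity, pairing, DvHor_eq H hρ, DvHor_eq H hρ, gtilde_hor σ lam H hρ,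
    gtilde_hor σ lam H hρ]
  simp [graphPt, curvatureTerm]
  ring

omit [FiniteDimensional ℝ E] in
theorem pullOmegaLam_eq (H : PeriodicHamiltonian E M) (ρ : ℝ → ℝ) (u : ℝ × ℝ → M) (z : ℝ × ℝ) :
    pullOmegaLam ω H ρ σ lam u z = pullOmegaE ω H ρ b u z + lam * σ.density z := by
  simp [pullOmegaLam, pullOmegaE, omegaLam, Dv, graphPt]

/-- The function `ω(∂_τ u, ∂_t u - X_ρ)`. -/
def fiberArea (ω : SymplecticForm E M) (H : PeriodicHamiltonian E M) (ρ : ℝ → ℝ) (b : Base)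
    (u : ℝ × ℝ → M) (z : ℝ × ℝ) : ℝ :=
  ω.form (graphPt u z).2.2 (Dv E b u z (1, 0)).2.2
    ((Dv E b u z (0, 1)).2.2 - Xρ ω H ρ (graphPt u z))

/-- Since `∂_τ` has no `dt` component, the second half of `dH_ρ ∧ dt` is zero. The fibre part of the
first half is `ω(X_ρ, ∂_τ u) = -ω(∂_τ u, X_ρ)`, which completes `ω(∂_τ u, ∂_t u)` to the fibre area.
-/
theorem pullOmegaE_eq (H : PeriodicHamiltonian E M) {ρ : ℝ → ℝ}
    (hρ : Differentiable ℝ ρ) (u : ℝ × ℝ → M) (z : ℝ × ℝ) :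
    pullOmegaE ω H ρ b u z = fiberArea ω H ρ b u z + curvatureTerm H ρ u z := by
  rw [pullOmegaE, omegaE, dHρ_apply (ω := ω) H hρ (graphPt u z) (Dv E b u z (1, 0)), fiberArea,
    curvatureTerm, map_sub, ω.form_swap _ (Xρ ω H ρ (graphPt u z))]
  simp [Dv, graphPt]
  ring

/-! ### Consequences of holomorphy for the densities. -/

section Holomorphic

variable {H : PeriodicHamiltonian E M} {ρ : ℝ → ℝ} {J : CompatibleFamily ω} {u : ℝ × ℝ → M}

omit [FiniteDimensional ℝ E] in
/-- The Cauchy–Riemann–Floer equation `∂_t u - X_ρ = J ∂_τ u`. -/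
theorem IsHolomorphic.floer_eq (hol : IsHolomorphic H ρ J b u) {z : ℝ × ℝ} (hz : z ∈ b.cover) :
    (Dv E b u z (0, 1)).2.2 - Xρ ω H ρ (graphPt u z) =
      J.toFun (ρ z.1) z.2 (graphPt u z).2.2 (Dv E b u z (1, 0)).2.2 := by
  -- The fibre component of `Dv(∂_t) = J̃ Dv(∂_τ)`; for `∂_τ` one has `α = 1`, `β = 0`.
  have h := congrArg (fun V => V.2.2) (hol z hz (1, 0))
  have e1 : (Dv E b u z (1, 0)).1 = 1 := rfl
  have e2 : (Dv E b u z (1, 0)).2.1 = 0 := rfl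
  simp only [Jtilde, neg_zero, e1, e2, zero_smul, sub_zero, one_smul] at h
  rw [sub_eq_iff_eq_add]
  exact h

/-- With `ξ = ∂_τ u`, the two frame vectors contribute `ω(ξ, Jξ)` and `ω(Jξ, JJξ)`, which agree by
`J`-invariance. The range of `ρ` matters because `J^s_t` is compatible only for `s ∈ [0, 1]`. -/
theorem IsHolomorphic.vertDensity_eq (hol : IsHolomorphic H ρ J b u) (hρ : Differentiable ℝ ρ)
    (hI : ∀ τ, ρ τ ∈ Icc (0 : ℝ) 1) {z : ℝ × ℝ} (hz : z ∈ b.cover) :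
    vertDensity H ρ J σ lam u z = 2 * fiberArea ω H ρ b u z := by
  rw [vertDensity, pairing, DvVert_eq H hρ, DvVert_eq H hρ, gtilde_vert, gtilde_vert]
  have h := hol.floer_eq hz
  rw [fiberArea]
  simp only [zero_smul, sub_zero, one_smul]
  rw [h]
  have h2 := J.invariant (ρ z.1) (hI z.1) z.2 (graphPt u z).2.2 (Dv E b u z (1, 0)).2.2
    (J.toFun (ρ z.1) z.2 (graphPt u z).2.2 (Dv E b u z (1, 0)).2.2)
  rw [two_mul]
  exact congrArg₂ (· + ·) rfl h2

omit [FiniteDimensional ℝ E] in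
theorem IsHolomorphic.fiberArea_nonneg (hol : IsHolomorphic H ρ J b u)
    (hI : ∀ τ, ρ τ ∈ Icc (0 : ℝ) 1) {z : ℝ × ℝ} (hz : z ∈ b.cover) :
    0 ≤ fiberArea ω H ρ b u z := by
  rw [fiberArea, hol.floer_eq hz]
  by_cases h : (Dv E b u z (1, 0)).2.2 = 0
  · rw [h]; simp
  · exact (J.pos _ (hI z.1) _ _ _ h).le

omit [FiniteDimensional ℝ E] in
-- Each frame vector contributes `Ω_λ(Dv(∂_τ), Dv(∂_t))`: directly for `∂_τ`, and by antisymmetry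
-- for `∂_t`, where `J̃ Dv(∂_t) = Dv(-∂_τ)`. This links finite energy to integrability of `v^*Ω_λ`.
theorem IsHolomorphic.energyDensity_eq (hol : IsHolomorphic H ρ J b u)
    {z : ℝ × ℝ} (hz : z ∈ b.cover) :
    energyDensity H ρ J σ lam u z = 2 * pullOmegaLam ω H ρ σ lam u z := by
  have h1 := hol z hz (1, 0)
  have h2 := hol z hz (0, 1)
  have hneg : Dv E b u z (-1, 0) = (-1 : ℝ) • Dv E b u z (1, 0) := by
    have : ((-1, 0) : ℝ × ℝ) = (-1 : ℝ) • ((1, 0) : ℝ × ℝ) := by simp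
    rw [Dv, Dv, this]
    refine Prod.ext (by simp) (Prod.ext (by simp) ?_)
    exact map_smul (mfderivWithin 𝓘(ℝ, ℝ × ℝ) 𝓘(ℝ, E) u b.cover z) (-1 : ℝ) ((1, 0) : ℝ × ℝ)
  simp only [neg_zero] at h1 h2
  rw [energyDensity, pairing, gtilde, gtilde, ← h1, ← h2, hneg, pullOmegaLam]
  simp only [omegaLam, omegaE, dHρ_smul]
  rw [ω.form_swap (graphPt u z).2.2 (Dv E b u z (0, 1)).2.2]
  simp
  ring

end Holomorphic

end Algebra

/-! ### Continuity and measurability of the densities. -/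

section Regularity

variable {E : Type*} [NormedAddCommGroup E] [NormedSpace ℝ E]
  {M : Type*} [TopologicalSpace M] [ChartedSpace E M]

theorem Base.measurableSet_domain (b : Base) : MeasurableSet b.domain := by
  cases b
  · exact measurableSet_Iic
  · exact measurableSet_Ici
  · exact MeasurableSet.univ

/-- Derivatives are one-sided on the boundary of a half-cylinder; this keeps them unique there. -/
theorem Base.uniqueDiffOn_cover (b : Base) : UniqueDiffOn ℝ b.cover := by
  refine UniqueDiffOn.prod ?_ uniqueDiffOn_univ
  cases b
  · exact uniqueDiffOn_Iic 0
  · exact uniqueDiffOn_Ici 0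
  · exact uniqueDiffOn_univ

theorem Base.ae_mem_cover (b : Base) : ∀ᵐ z ∂b.measure, z ∈ b.cover := by
  filter_upwards [ae_restrict_mem (b.measurableSet_domain.prod measurableSet_Ioc)] with z hz
  exact ⟨hz.1, mem_univ _⟩

theorem Base.aemeasurable_of_continuousOn {b : Base} {f : ℝ × ℝ → ℝ}
    (hf : ContinuousOn f b.cover) : AEMeasurable f b.measure :=
  (hf.mono (prod_mono subset_rfl (subset_univ _))).aemeasurable
    (b.measurableSet_domain.prod measurableSet_Ioc)

variable {b : Base} {u : ℝ × ℝ → M} {H : PeriodicHamiltonian E M} {ρ : ℝ → ℝ}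

/-- The Hamiltonian `H_ρ` along the section is smooth. -/
theorem contDiffOn_cutoff_mul_comp (hρ : ContDiff ℝ (⊤ : ℕ∞) ρ)
    (hu : ContMDiffOn 𝓘(ℝ, ℝ × ℝ) 𝓘(ℝ, E) (⊤ : ℕ∞) u b.cover) :
    ContDiffOn ℝ (⊤ : ℕ∞) (fun z : ℝ × ℝ => ρ z.1 * H.toFun z.2 (u z)) b.cover := by
  have h1 : ContMDiffOn 𝓘(ℝ, ℝ × ℝ) 𝓘(ℝ, ℝ) (⊤ : ℕ∞) (fun z : ℝ × ℝ => H.toFun z.2 (u z)) b.cover :=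
    H.smooth.comp_contMDiffOn (ContMDiffOn.prodMk contDiff_snd.contMDiff.contMDiffOn hu)
  exact (hρ.comp contDiff_fst).contDiffOn.mul h1.contDiffOn

theorem continuousOn_curvatureTerm (hρ : ContDiff ℝ (⊤ : ℕ∞) ρ)
    (hu : ContMDiffOn 𝓘(ℝ, ℝ × ℝ) 𝓘(ℝ, E) (⊤ : ℕ∞) u b.cover) :
    ContinuousOn (curvatureTerm H ρ u) b.cover := by
  have h1 : ContMDiffOn 𝓘(ℝ, ℝ × ℝ) 𝓘(ℝ, ℝ) (⊤ : ℕ∞) (fun z : ℝ × ℝ => H.toFun z.2 (u z)) b.cover :=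
    H.smooth.comp_contMDiffOn (ContMDiffOn.prodMk contDiff_snd.contMDiff.contMDiffOn hu)
  exact ((hρ.continuous_deriv (by simp)).comp continuous_fst).continuousOn.mul h1.continuousOn

/-- The chain rule for `H_ρ` along the section. -/
theorem dHρ_Dv (hρ : ContDiff ℝ (⊤ : ℕ∞) ρ)
    (hu : ContMDiffOn 𝓘(ℝ, ℝ × ℝ) 𝓘(ℝ, E) (⊤ : ℕ∞) u b.cover) {z : ℝ × ℝ} (hz : z ∈ b.cover)
    (w : ℝ × ℝ) :
    dHρ H ρ (graphPt u z) (Dv E b u z w) =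
      fderivWithin ℝ (fun z : ℝ × ℝ => ρ z.1 * H.toFun z.2 (u z)) b.cover z w := by
  have hu' := ((hu z hz).mdifferentiableWithinAt (by simp)).hasMFDerivWithinAt
  have h1 : HasMFDerivWithinAt 𝓘(ℝ, ℝ × ℝ) 𝓘(ℝ, ℝ) (Prod.fst : ℝ × ℝ → ℝ) b.cover z
      (ContinuousLinearMap.fst ℝ ℝ ℝ) := hasFDerivWithinAt_fst.hasMFDerivWithinAt
  have h2 : HasMFDerivWithinAt 𝓘(ℝ, ℝ × ℝ) 𝓘(ℝ, ℝ) (Prod.snd : ℝ × ℝ → ℝ) b.cover z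
      (ContinuousLinearMap.snd ℝ ℝ ℝ) := hasFDerivWithinAt_snd.hasMFDerivWithinAt
  have hg := h1.prodMk (h2.prodMk hu')
  have hH := (mdifferentiableAt_cutoff_mul H (hρ.differentiable (by simp))
    (graphPt u z)).hasMFDerivAt
  have hc := HasMFDerivAt.comp_hasMFDerivWithinAt z hH hg
  have hd := (((contDiffOn_cutoff_mul_comp (H := H) hρ hu).differentiableOn (by simp)) z
    hz).hasFDerivWithinAt
  exact DFunLike.congr_fun
    ((b.uniqueDiffOn_cover.uniqueMDiffOn z hz).eq hc hd.hasMFDerivWithinAt) w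

variable [IsManifold 𝓘(ℝ, E) (⊤ : ℕ∞) M] {ω : SymplecticForm E M}

/-- The tangent map of `u` composed with the constant vector field `w`; one order of smoothness is
spent, and continuity is all that is needed. -/
theorem contMDiffOn_mfderivWithin_apply
    (hu : ContMDiffOn 𝓘(ℝ, ℝ × ℝ) 𝓘(ℝ, E) (⊤ : ℕ∞) u b.cover) (w : ℝ × ℝ) :
    ContMDiffOn 𝓘(ℝ, ℝ × ℝ) (𝓘(ℝ, E).prod 𝓘(ℝ, E)) 0
      (fun z => Bundle.TotalSpace.mk' E (E := fun x : M => TangentSpace 𝓘(ℝ, E) x) (u z)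
        (mfderivWithin 𝓘(ℝ, ℝ × ℝ) 𝓘(ℝ, E) u b.cover z w)) b.cover := by
  have : IsManifold 𝓘(ℝ, E) 1 M := IsManifold.of_le (n := ((⊤ : ℕ∞) : WithTop ℕ∞)) (by simp)
  have h := hu.contMDiffOn_tangentMapWithin (m := 0) (by simp)
    b.uniqueDiffOn_cover.uniqueMDiffOn
  have hs : ContMDiff 𝓘(ℝ, ℝ × ℝ) (𝓘(ℝ, ℝ × ℝ).prod 𝓘(ℝ, ℝ × ℝ)) 0
      (fun z : ℝ × ℝ => (⟨z, w⟩ : TangentBundle 𝓘(ℝ, ℝ × ℝ) (ℝ × ℝ))) := by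
    intro z
    rw [← contMDiffWithinAt_univ]
    exact contMDiffWithinAt_vectorSpace_iff_contDiffWithinAt.2 contDiffWithinAt_const
  exact h.comp hs.contMDiffOn fun z hz => hz

/-- `ω` along `u` is a continuous section of a bundle of bilinear forms. Evaluating it on two
continuous vector fields along `u` gives a section of the trivial line bundle, whose fibre
coordinate is the function. -/
theorem continuousOn_form_mfderivWithin
    (hu : ContMDiffOn 𝓘(ℝ, ℝ × ℝ) 𝓘(ℝ, E) (⊤ : ℕ∞) u b.cover) (w w' : ℝ × ℝ) :
    ContinuousOn (fun z => ω.form (u z) (mfderivWithin 𝓘(ℝ, ℝ × ℝ) 𝓘(ℝ, E) u b.cover z w)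
      (mfderivWithin 𝓘(ℝ, ℝ × ℝ) 𝓘(ℝ, E) u b.cover z w')) b.cover := by
  have : IsManifold 𝓘(ℝ, E) 1 M := IsManifold.of_le (n := ((⊤ : ℕ∞) : WithTop ℕ∞)) (by simp)
  intro z hz
  have h : ContMDiffWithinAt 𝓘(ℝ, ℝ × ℝ) (𝓘(ℝ, E).prod 𝓘(ℝ, ℝ)) 0
      (fun z => Bundle.TotalSpace.mk' ℝ (E := Bundle.Trivial M ℝ) (u z)
        (ω.form (u z) (mfderivWithin 𝓘(ℝ, ℝ × ℝ) 𝓘(ℝ, E) u b.cover z w)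
          (mfderivWithin 𝓘(ℝ, ℝ × ℝ) 𝓘(ℝ, E) u b.cover z w'))) b.cover z := by
    apply ContMDiffWithinAt.clm_bundle_apply₂ (F₁ := E) (F₂ := E)
    · exact ((ω.smooth.of_le (by simp)).contMDiffAt).comp_contMDiffWithinAt z
        ((hu z hz).of_le (by simp))
    · exact contMDiffOn_mfderivWithin_apply hu w z hz
    · exact contMDiffOn_mfderivWithin_apply hu w' z hz
  simp only [Bundle.contMDiffWithinAt_totalSpace] at h
  exact h.2.continuousWithinAt

theorem continuousOn_pullOmegaE (hρ : ContDiff ℝ (⊤ : ℕ∞) ρ)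
    (hu : ContMDiffOn 𝓘(ℝ, ℝ × ℝ) 𝓘(ℝ, E) (⊤ : ℕ∞) u b.cover) :
    ContinuousOn (pullOmegaE ω H ρ b u) b.cover := by
  have h1 := continuousOn_form_mfderivWithin (ω := ω) hu (1, 0) (0, 1)
  have h2 := (contDiffOn_cutoff_mul_comp (H := H) hρ hu).continuousOn_fderivWithin
    b.uniqueDiffOn_cover (by simp)
  -- The density equals `ω(∂_τ u, ∂_t u) + ∂_τ(H_ρ ∘ graph)`, so regularity of `X_ρ` is not needed.
  refine (h1.add (h2.clm_apply (continuousOn_const (c := ((1, 0) : ℝ × ℝ))))).congr fun z hz => ?_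
  rw [pullOmegaE, omegaE, dHρ_Dv hρ hu hz]
  simp [Dv, graphPt]
  rfl

end Regularity

/-! ### Integrals with values in `(-∞, +∞]`. -/

section ExtendedIntegral

variable {μ : Measure (ℝ × ℝ)} {f g : ℝ × ℝ → ℝ}

theorem QuasiIntegrable.of_le (hf : AEMeasurable f μ) (hg : Integrable g μ) (hgf : g ≤ᵐ[μ] f) :
    QuasiIntegrable f μ := by
  refine ⟨hf, ((lintegral_mono_ae ?_).trans_lt hg.neg.lintegral_lt_top).ne⟩
  filter_upwards [hgf] with z hz
  exact ENNReal.ofReal_le_ofReal (neg_le_neg hz)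

theorem extIntegral_of_integrable (hf : Integrable f μ) :
    extIntegral f μ = ((∫ z, f z ∂μ : ℝ) : EReal) := by
  rw [integral_eq_lintegral_pos_part_sub_lintegral_neg_part hf, EReal.coe_sub, extIntegral,
    ← EReal.coe_ennreal_toReal hf.lintegral_lt_top.ne]
  congr 1
  exact (EReal.coe_ennreal_toReal hf.neg.lintegral_lt_top.ne).symm

/-- Were the positive part finite too, `|f| ≤ f⁺ + f⁻` would make `f` integrable. -/
theorem QuasiIntegrable.extIntegral_eq_top (hf : QuasiIntegrable f μ) (h : ¬ Integrable f μ) :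
    extIntegral f μ = ⊤ := by
  have hpos : ∫⁻ z, ENNReal.ofReal (f z) ∂μ = ⊤ := by
    by_contra hne
    refine h ⟨hf.1.aestronglyMeasurable, ?_⟩
    rw [hasFiniteIntegral_iff_norm]
    calc ∫⁻ z, ENNReal.ofReal ‖f z‖ ∂μ
        ≤ ∫⁻ z, (ENNReal.ofReal (f z) + ENNReal.ofReal (-f z)) ∂μ := by
          refine lintegral_mono fun z => ?_
          rw [Real.norm_eq_abs]
          rcases abs_choice (f z) with h | h <;> rw [h]
          · exact le_self_add
          · exact le_add_self
      _ = ∫⁻ z, ENNReal.ofReal (f z) ∂μ + ∫⁻ z, ENNReal.ofReal (-f z) ∂μ :=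
          lintegral_add_left' hf.1.ennreal_ofReal _
      _ < ⊤ := ENNReal.add_lt_top.2 ⟨lt_top_iff_ne_top.2 hne, lt_top_iff_ne_top.2 hf.2⟩
  rw [extIntegral, hpos, ← EReal.coe_ennreal_toReal hf.2]
  exact EReal.top_sub_coe _

/-- If `f ≥ 0` and `g` is integrable, the extended integral of `f + g` is defined, and
`½ ∫ 2f = ∫ (f + g) - ∫ g`. -/
theorem half_extIntegral_eq {F G : ℝ × ℝ → ℝ} (hf : AEMeasurable f μ) (h0 : 0 ≤ᵐ[μ] f)
    (hg : Integrable g μ) (hF : F =ᵐ[μ] fun z => 2 * f z) (hG : G =ᵐ[μ] fun z => f z + g z) :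
    QuasiIntegrable F μ ∧ QuasiIntegrable G μ ∧
      ((1 / 2 : ℝ) : EReal) * extIntegral F μ = extIntegral G μ - ((∫ z, g z ∂μ : ℝ) : EReal) := by
  have hFq : QuasiIntegrable F μ := by
    refine .of_le ((hf.const_mul 2).congr hF.symm) (integrable_zero _ ℝ μ) ?_
    filter_upwards [hF, h0] with z h1 h2
    rw [h1]
    exact mul_nonneg zero_le_two h2
  have hGq : QuasiIntegrable G μ := by
    refine .of_le ((hf.add hg.aemeasurable).congr hG.symm) hg ?_
    filter_upwards [hG, h0] with z h1 h2
    rw [h1]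
    exact le_add_of_nonneg_left h2
  refine ⟨hFq, hGq, ?_⟩
  -- If `f` is not integrable, neither is `2f` nor `f + g`, so both sides are `⊤`; subtracting the
  -- finite `∫ g` does not change this.
  by_cases h : Integrable f μ
  · rw [extIntegral_of_integrable ((h.const_mul 2).congr hF.symm),
      extIntegral_of_integrable ((h.add hg).congr hG.symm), ← EReal.coe_mul, ← EReal.coe_sub,
      integral_congr_ae hF, integral_congr_ae hG, integral_add h hg, integral_const_mul]
    congr 1
    ring
  · have h1 : ¬ Integrable F μ := fun hi => h <| by
      refine (hi.const_mul (1 / 2)).congr ?_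
      filter_upwards [hF] with z hz
      rw [hz]
      ring
    have h2 : ¬ Integrable G μ := fun hi => h <| by
      refine (hi.sub hg).congr ?_
      filter_upwards [hG] with z hz
      simp [hz]
    rw [hFq.extIntegral_eq_top h1, hGq.extIntegral_eq_top h2,
      EReal.coe_mul_top_of_pos (by norm_num), EReal.top_sub_coe]

end ExtendedIntegral

/-! ### Cut-off functions and the curvature integral. -/

section Cutoff

theorem IsDecreasingCutoff.mem_Icc {A B : ℝ} {ρ : ℝ → ℝ} (h : IsDecreasingCutoff A B ρ) (τ : ℝ) :
    ρ τ ∈ Icc (0 : ℝ) 1 := by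
  have hm := antitone_of_deriv_nonpos (h.smooth.differentiable (by simp)) h.deriv_nonpos
  refine ⟨?_, ?_⟩
  -- Compare `τ` with a point at or beyond it where the cut-off has already become constant.
  · rw [← h.eq_zero (max τ B) (le_max_right _ _)]
    exact hm (le_max_left _ _)
  · rw [← h.eq_one (min τ A) (min_le_right _ _)]
    exact hm (min_le_left _ _)

theorem IsIncreasingCutoff.mem_Icc {A B : ℝ} {ρ : ℝ → ℝ} (h : IsIncreasingCutoff A B ρ) (τ : ℝ) :
    ρ τ ∈ Icc (0 : ℝ) 1 := by
  have hm := monotone_of_deriv_nonneg (h.smooth.differentiable (by simp)) h.deriv_nonneg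
  refine ⟨?_, ?_⟩
  · rw [← h.eq_zero (min τ A) (min_le_right _ _)]
    exact hm (min_le_left _ _)
  · rw [← h.eq_one (max τ B) (le_max_right _ _)]
    exact hm (le_max_left _ _)

theorem deriv_eq_zero_of_const_outside {A B c d : ℝ} {ρ : ℝ → ℝ} (hA : ∀ τ, τ ≤ A → ρ τ = c)
    (hB : ∀ τ, B ≤ τ → ρ τ = d) {τ : ℝ} (hτ : τ ∉ Icc A B) : deriv ρ τ = 0 := by
  rw [mem_Icc, not_and_or, not_le, not_le] at hτ
  rcases hτ with hτ | hτ
  · have : ρ =ᶠ[nhds τ] fun _ => c := by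
      filter_upwards [Iio_mem_nhds hτ] with s hs using hA s (le_of_lt hs)
    rw [this.deriv_eq, deriv_const]
  · have : ρ =ᶠ[nhds τ] fun _ => d := by
      filter_upwards [Ioi_mem_nhds hτ] with s hs using hB s (le_of_lt hs)
    rw [this.deriv_eq, deriv_const]

theorem IsDecreasingCutoff.deriv_eq_zero {A B : ℝ} {ρ : ℝ → ℝ} (h : IsDecreasingCutoff A B ρ)
    (τ : ℝ) (hτ : τ ∉ Icc A B) : deriv ρ τ = 0 :=
  deriv_eq_zero_of_const_outside h.eq_one h.eq_zero hτ

theorem IsIncreasingCutoff.deriv_eq_zero {A B : ℝ} {ρ : ℝ → ℝ} (h : IsIncreasingCutoff A B ρ)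
    (τ : ℝ) (hτ : τ ∉ Icc A B) : deriv ρ τ = 0 :=
  deriv_eq_zero_of_const_outside h.eq_zero h.eq_one hτ

theorem Base.Radii.left_le_right {b : Base} {R₁ R₂ : ℝ} (h : b.Radii R₁ R₂) :
    b.left R₁ R₂ ≤ b.right R₁ R₂ := by
  cases b <;> simp only [Base.Radii, Base.left, Base.right] at * <;> linarith

/-- On the half-cylinders this is where `0 < R₁` enters: the whole variation of `ρ` takes place
inside the base. -/
theorem Base.Radii.Icc_subset_domain {b : Base} {R₁ R₂ : ℝ} (h : b.Radii R₁ R₂) :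
    Icc (b.left R₁ R₂) (b.right R₁ R₂) ⊆ b.domain := by
  intro τ hτ
  cases b
  · exact hτ.2.trans (neg_nonpos.2 h.1.le)
  · exact h.1.le.trans hτ.1
  · trivial

/-- On the fundamental domain the function vanishes off the compact rectangle `[A, B] × [0, 1]`,
where continuity suffices. -/
theorem Base.integrable_of_continuousOn {b : Base} {A B : ℝ} {f : ℝ × ℝ → ℝ}
    (hsub : Icc A B ⊆ b.domain) (hf : ContinuousOn f b.cover)
    (h0 : ∀ z : ℝ × ℝ, z.1 ∉ Icc A B → f z = 0) : Integrable f b.measure := by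
  have h : IntegrableOn f (Icc A B ×ˢ Icc (0 : ℝ) 1) :=
    (hf.mono (prod_mono hsub (subset_univ _))).integrableOn_compact
      (isCompact_Icc.prod isCompact_Icc)
  exact h.of_forall_sdiff_eq_zero (b.measurableSet_domain.prod measurableSet_Ioc)
    fun z hz => h0 z fun h1 => hz.2 ⟨h1, hz.1.2.1.le, hz.1.2.2⟩

variable {b : Base} {A B : ℝ} {ρ m : ℝ → ℝ}

theorem setIntegral_deriv_cutoff (hsub : Icc A B ⊆ b.domain) (hAB : A ≤ B)
    (hρ : ContDiff ℝ (⊤ : ℕ∞) ρ) (h0 : ∀ τ, τ ∉ Icc A B → deriv ρ τ = 0) :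
    ∫ τ in b.domain, deriv ρ τ = ρ B - ρ A := by
  rw [setIntegral_eq_of_subset_of_forall_sdiff_eq_zero b.measurableSet_domain hsub
    fun τ hτ => h0 τ hτ.2, integral_Icc_eq_integral_Ioc, ← intervalIntegral.integral_of_le hAB]
  exact intervalIntegral.integral_deriv_eq_sub (fun τ _ => hρ.differentiable (by simp) τ)
    ((hρ.continuous_deriv (by simp)).intervalIntegrable _ _)

/-- Fubini for a product integrand; the `τ` factor is evaluated by the fundamental theorem of
calculus. -/
theorem integral_deriv_cutoff_mul (hsub : Icc A B ⊆ b.domain) (hAB : A ≤ B)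
    (hρ : ContDiff ℝ (⊤ : ℕ∞) ρ) (h0 : ∀ τ, τ ∉ Icc A B → deriv ρ τ = 0) :
    ∫ z, deriv ρ z.1 * m z.2 ∂b.measure = (ρ B - ρ A) * ∫ t in (0 : ℝ)..1, m t := by
  rw [Base.measure, Measure.volume_eq_prod, ← Measure.prod_restrict, integral_prod_mul,
    setIntegral_deriv_cutoff hsub hAB hρ h0, intervalIntegral.integral_of_le zero_le_one]

variable {E : Type*} [NormedAddCommGroup E] [NormedSpace ℝ E]
  {M : Type*} [TopologicalSpace M] [ChartedSpace E M]
  {H : PeriodicHamiltonian E M} {u : ℝ × ℝ → M}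

theorem integrable_curvatureTerm (hsub : Icc A B ⊆ b.domain)
    (hρ : ContDiff ℝ (⊤ : ℕ∞) ρ) (h0 : ∀ τ, τ ∉ Icc A B → deriv ρ τ = 0)
    (hu : ContMDiffOn 𝓘(ℝ, ℝ × ℝ) 𝓘(ℝ, E) (⊤ : ℕ∞) u b.cover) :
    Integrable (curvatureTerm H ρ u) b.measure :=
  Base.integrable_of_continuousOn hsub (continuousOn_curvatureTerm hρ hu)
    fun z hz => by rw [curvatureTerm, h0 _ hz, zero_mul]

/-- A lower bound of `ρ'(τ) H(t, u)` by `ρ'(τ) m(t)` integrates to one of its integral. -/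
theorem le_integral_curvatureTerm (hsub : Icc A B ⊆ b.domain) (hAB : A ≤ B)
    (hρ : ContDiff ℝ (⊤ : ℕ∞) ρ) (h0 : ∀ τ, τ ∉ Icc A B → deriv ρ τ = 0)
    (hu : ContMDiffOn 𝓘(ℝ, ℝ × ℝ) 𝓘(ℝ, E) (⊤ : ℕ∞) u b.cover) (hm : Continuous m)
    (hle : ∀ z, deriv ρ z.1 * m z.2 ≤ curvatureTerm H ρ u z) :
    (ρ B - ρ A) * ∫ t in (0 : ℝ)..1, m t ≤ ∫ z, curvatureTerm H ρ u z ∂b.measure := by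
  rw [← integral_deriv_cutoff_mul hsub hAB hρ h0]
  refine integral_mono (Base.integrable_of_continuousOn hsub ?_ fun z hz => ?_)
    (integrable_curvatureTerm hsub hρ h0 hu) hle
  · exact (((hρ.continuous_deriv (by simp)).comp continuous_fst).mul
      (hm.comp continuous_snd)).continuousOn
  · rw [h0 _ hz, zero_mul]

variable [CompactSpace M]

theorem PeriodicHamiltonian.continuous_iSup (H : PeriodicHamiltonian E M) :
    Continuous fun t => ⨆ x, H.toFun t x := by
  simpa only [image_univ, sSup_range, sInf_range] using isCompact_univ.continuous_sSup (f := H.toFun) H.smooth.continuous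

theorem PeriodicHamiltonian.continuous_iInf (H : PeriodicHamiltonian E M) :
    Continuous fun t => ⨅ x, H.toFun t x := by
  simpa only [image_univ, sSup_range, sInf_range] using isCompact_univ.continuous_sInf (f := H.toFun) H.smooth.continuous

theorem PeriodicHamiltonian.isCompact_range (H : PeriodicHamiltonian E M) (t : ℝ) :
    IsCompact (range (H.toFun t)) :=
  _root_.isCompact_range (H.smooth.continuous.comp (continuous_const.prodMk continuous_id))

theorem IsDecreasingCutoff.neg_integral_iSup_le (h : IsDecreasingCutoff A B ρ)
    (hsub : Icc A B ⊆ b.domain) (hAB : A ≤ B)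
    (hu : ContMDiffOn 𝓘(ℝ, ℝ × ℝ) 𝓘(ℝ, E) (⊤ : ℕ∞) u b.cover) :
    -∫ t in (0 : ℝ)..1, ⨆ x, H.toFun t x ≤ ∫ z, curvatureTerm H ρ u z ∂b.measure := by
  have := le_integral_curvatureTerm (H := H) hsub hAB h.smooth h.deriv_eq_zero hu H.continuous_iSup
    fun z => mul_le_mul_of_nonpos_left (le_ciSup (H.isCompact_range z.2).bddAbove (u z))
      (h.deriv_nonpos z.1)
  -- Here `ρ(B) - ρ(A) = -1`, which accounts for the sign in front of the integral of the maximum.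
  rwa [h.eq_zero B le_rfl, h.eq_one A le_rfl, zero_sub, neg_one_mul] at this

theorem IsIncreasingCutoff.integral_iInf_le (h : IsIncreasingCutoff A B ρ)
    (hsub : Icc A B ⊆ b.domain) (hAB : A ≤ B)
    (hu : ContMDiffOn 𝓘(ℝ, ℝ × ℝ) 𝓘(ℝ, E) (⊤ : ℕ∞) u b.cover) :
    ∫ t in (0 : ℝ)..1, ⨅ x, H.toFun t x ≤ ∫ z, curvatureTerm H ρ u z ∂b.measure := by
  have := le_integral_curvatureTerm (H := H) hsub hAB h.smooth h.deriv_eq_zero hu H.continuous_iInf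
    fun z => mul_le_mul_of_nonneg_left (ciInf_le (H.isCompact_range z.2).bddBelow (u z))
      (h.deriv_nonneg z.1)
  rwa [h.eq_zero A le_rfl, h.eq_one B le_rfl, sub_zero, one_mul] at this

end Cutoff

end DeformedCylinder

end

/-! ### Assembly: integrating the pointwise identities. -/

theorem proposition3p4
    {E : Type*} [NormedAddCommGroup E] [NormedSpace ℝ E] [FiniteDimensional ℝ E]
    {M : Type*} [TopologicalSpace M] [T2Space M] [CompactSpace M] [ChartedSpace E M]
    [IsManifold 𝓘(ℝ, E) (⊤ : ℕ∞) M]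
    (ω : DeformedCylinder.SymplecticForm E M)
    (H : DeformedCylinder.PeriodicHamiltonian E M)
    (φ : DeformedCylinder.HamiltonianIsotopy ω H)
    (J : DeformedCylinder.CompatibleFamily ω)
    (b : DeformedCylinder.Base) (R₁ R₂ : ℝ) (hR : b.Radii R₁ R₂) (ρ : ℝ → ℝ)
    (hρ : DeformedCylinder.IsDecreasingCutoff (b.left R₁ R₂) (b.right R₁ R₂) ρ ∨
      DeformedCylinder.IsIncreasingCutoff (b.left R₁ R₂) (b.right R₁ R₂) ρ)
    (σ : DeformedCylinder.AreaForm b) (lam : ℝ)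
    (v : ℝ × AddCircle (1 : ℝ) → DeformedCylinder.MappingCylinder (φ.path ρ))
    (hv : DeformedCylinder.IsSmoothSection φ ρ b v)
    (u : ℝ × ℝ → M) (hu : u = DeformedCylinder.coordMap φ ρ v)
    (hol : DeformedCylinder.IsHolomorphic H ρ J b u) :
    -- vertical and horizontal parts are orthogonal
    (∀ z ∈ b.cover, ∀ w w' : ℝ × ℝ,
      DeformedCylinder.gtilde H ρ J σ lam (DeformedCylinder.graphPt u z)
        (DeformedCylinder.DvVert ω H ρ b u z w) (DeformedCylinder.DvHor ω H ρ b u z w') = 0) ∧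
    -- the integrals below are all defined, with values in `(-∞, +∞]`
    ((∀ z ∈ b.cover, 0 ≤ DeformedCylinder.vertDensity H ρ J σ lam u z) ∧
      DeformedCylinder.QuasiIntegrable (DeformedCylinder.vertDensity H ρ J σ lam u) b.measure ∧
      DeformedCylinder.QuasiIntegrable (DeformedCylinder.pullOmegaLam ω H ρ σ lam u) b.measure ∧
      DeformedCylinder.QuasiIntegrable (DeformedCylinder.pullOmegaE ω H ρ b u) b.measure ∧
      Integrable (DeformedCylinder.horDensity H ρ J σ lam u) b.measure ∧
      Integrable (DeformedCylinder.crossDensity H ρ J σ lam u) b.measure ∧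
      Integrable (DeformedCylinder.curvatureTerm H ρ u) b.measure) ∧
    -- the formula for the vertical energy
    (((1 / 2 : ℝ) : EReal) *
        DeformedCylinder.extIntegral (DeformedCylinder.vertDensity H ρ J σ lam u) b.measure
      = DeformedCylinder.extIntegral (DeformedCylinder.pullOmegaLam ω H ρ σ lam u) b.measure
        - (((1 / 2) * ∫ z, DeformedCylinder.horDensity H ρ J σ lam u z ∂b.measure : ℝ) : EReal)
        - ((∫ z, DeformedCylinder.crossDensity H ρ J σ lam u z ∂b.measure : ℝ) : EReal)) ∧
    (((1 / 2 : ℝ) : EReal) *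
        DeformedCylinder.extIntegral (DeformedCylinder.vertDensity H ρ J σ lam u) b.measure
      = DeformedCylinder.extIntegral (DeformedCylinder.pullOmegaE ω H ρ b u) b.measure
        - ((∫ z, DeformedCylinder.curvatureTerm H ρ u z ∂b.measure : ℝ) : EReal)) ∧
    -- sections of finite energy
    (Integrable (DeformedCylinder.energyDensity H ρ J σ lam u) b.measure →
      Integrable (DeformedCylinder.vertDensity H ρ J σ lam u) b.measure ∧
      Integrable (DeformedCylinder.pullOmegaLam ω H ρ σ lam u) b.measure ∧
      Integrable (DeformedCylinder.pullOmegaE ω H ρ b u) b.measure ∧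
      (1 / 2) * ∫ z, DeformedCylinder.vertDensity H ρ J σ lam u z ∂b.measure
        = (∫ z, DeformedCylinder.pullOmegaLam ω H ρ σ lam u z ∂b.measure)
          - (1 / 2) * (∫ z, DeformedCylinder.horDensity H ρ J σ lam u z ∂b.measure)
          - ∫ z, DeformedCylinder.crossDensity H ρ J σ lam u z ∂b.measure ∧
      (1 / 2) * ∫ z, DeformedCylinder.vertDensity H ρ J σ lam u z ∂b.measure
        = (∫ z, DeformedCylinder.pullOmegaE ω H ρ b u z ∂b.measure)
          - ∫ z, DeformedCylinder.curvatureTerm H ρ u z ∂b.measure ∧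
      (DeformedCylinder.IsDecreasingCutoff (b.left R₁ R₂) (b.right R₁ R₂) ρ →
        (1 / 2) * ∫ z, DeformedCylinder.vertDensity H ρ J σ lam u z ∂b.measure
          ≤ (∫ z, DeformedCylinder.pullOmegaE ω H ρ b u z ∂b.measure)
            + ∫ t in (0 : ℝ)..1, ⨆ x : M, H t x) ∧
      (DeformedCylinder.IsIncreasingCutoff (b.left R₁ R₂) (b.right R₁ R₂) ρ →
        (1 / 2) * ∫ z, DeformedCylinder.vertDensity H ρ J σ lam u z ∂b.measure
          ≤ (∫ z, DeformedCylinder.pullOmegaE ω H ρ b u z ∂b.measure)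
            + ∫ t in (0 : ℝ)..1, -⨅ x : M, H t x)) := by
  have hu' : ContMDiffOn 𝓘(ℝ, ℝ × ℝ) 𝓘(ℝ, E) (⊤ : ℕ∞) u b.cover := hu ▸ hv.smooth
  have hsub := hR.Icc_subset_domain
  have hAB := hR.left_le_right
  have hsm : ContDiff ℝ (⊤ : ℕ∞) ρ := hρ.elim (·.smooth) (·.smooth)
  have hI : ∀ τ, ρ τ ∈ Icc (0 : ℝ) 1 := hρ.elim (·.mem_Icc) (·.mem_Icc)
  have h0 : ∀ τ, τ ∉ Icc (b.left R₁ R₂) (b.right R₁ R₂) → deriv ρ τ = 0 :=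
    hρ.elim (·.deriv_eq_zero) (·.deriv_eq_zero)
  have hd : Differentiable ℝ ρ := hsm.differentiable (by simp)
  have hcurv : Integrable (DeformedCylinder.curvatureTerm H ρ u) b.measure :=
    DeformedCylinder.integrable_curvatureTerm hsub hsm h0 hu'
  have hσ : Integrable (fun z => lam * σ.density z) b.measure := σ.integrable.const_mul lam
  have hcross : DeformedCylinder.crossDensity H ρ J σ lam u = fun _ => 0 :=
    funext fun z => DeformedCylinder.crossDensity_eq_zero σ lam H hd J u z
  have hhor : DeformedCylinder.horDensity H ρ J σ lam u =
      fun z => 2 * (DeformedCylinder.curvatureTerm H ρ u z + lam * σ.density z) :=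
    funext fun z => DeformedCylinder.horDensity_eq σ lam H hd J u z
  have hE : DeformedCylinder.pullOmegaE ω H ρ b u =
      fun z => DeformedCylinder.fiberArea ω H ρ b u z + DeformedCylinder.curvatureTerm H ρ u z :=
    funext fun z => DeformedCylinder.pullOmegaE_eq H hd u z
  have hL : DeformedCylinder.pullOmegaLam ω H ρ σ lam u =
      fun z => DeformedCylinder.fiberArea ω H ρ b u z
        + (DeformedCylinder.curvatureTerm H ρ u z + lam * σ.density z) :=
    funext fun z => by
      rw [DeformedCylinder.pullOmegaLam_eq, DeformedCylinder.pullOmegaE_eq H hd, add_assoc]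
  have hvert : DeformedCylinder.vertDensity H ρ J σ lam u =ᵐ[b.measure]
      fun z => 2 * DeformedCylinder.fiberArea ω H ρ b u z := by
    filter_upwards [b.ae_mem_cover] with z hz using hol.vertDensity_eq σ lam hd hI hz
  have harea0 : 0 ≤ᵐ[b.measure] DeformedCylinder.fiberArea ω H ρ b u := by
    filter_upwards [b.ae_mem_cover] with z hz using hol.fiberArea_nonneg hI hz
  -- Measurability is read off from `a = v^*ω_E - ρ' H`, a difference of continuous functions,
  -- because `X_ρ` in the definition of `a` comes from a choice.
  have haream : AEMeasurable (DeformedCylinder.fiberArea ω H ρ b u) b.measure := by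
    have h := DeformedCylinder.Base.aemeasurable_of_continuousOn
      ((DeformedCylinder.continuousOn_pullOmegaE (ω := ω) (H := H) hsm hu').sub
        (DeformedCylinder.continuousOn_curvatureTerm (H := H) hsm hu'))
    refine h.congr (Filter.Eventually.of_forall fun z => ?_)
    simp [hE]
  obtain ⟨hvq, hEq, hEform⟩ := DeformedCylinder.half_extIntegral_eq haream harea0 hcurv hvert
    (Filter.EventuallyEq.of_eq hE)
  -- The same identity with `g = ρ' H + λσ`, which is half the horizontal density, in place of `g =
  -- ρ' H`.
  obtain ⟨-, hLq, hLform⟩ := DeformedCylinder.half_extIntegral_eq haream harea0 (hcurv.add hσ) hvert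
    (Filter.EventuallyEq.of_eq hL)
  have hhorInt : ∫ z, DeformedCylinder.horDensity H ρ J σ lam u z ∂b.measure =
      2 * ∫ z, (DeformedCylinder.curvatureTerm H ρ u z + lam * σ.density z) ∂b.measure := by
    rw [hhor, integral_const_mul]
  have hcrossInt : ∫ z, DeformedCylinder.crossDensity H ρ J σ lam u z ∂b.measure = 0 := by
    simp [hcross]
  refine ⟨fun z _ w w' => DeformedCylinder.gtilde_DvVert_DvHor σ lam H hd J u z w w',
    ⟨fun z hz => ?_, hvq, hLq, hEq, ?_, ?_, hcurv⟩, ?_, hEform, fun hen => ?_⟩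
  · rw [hol.vertDensity_eq σ lam hd hI hz]
    exact mul_nonneg zero_le_two (hol.fiberArea_nonneg hI hz)
  · rw [hhor]
    exact (hcurv.add hσ).const_mul 2
  · rw [hcross]
    exact integrable_zero _ _ _
  · rw [hhorInt, hcrossInt, EReal.coe_zero, sub_zero, one_div, inv_mul_cancel_left₀ two_ne_zero,
      ← one_div]
    exact hLform
  · have hLi : Integrable (DeformedCylinder.pullOmegaLam ω H ρ σ lam u) b.measure := by
      refine (hen.const_mul (1 / 2)).congr ?_
      filter_upwards [b.ae_mem_cover] with z hz
      rw [hol.energyDensity_eq σ lam hz]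
      ring
    -- `a` is `v^*Ω_λ` minus the integrable function `ρ' H + λσ`; all remaining finiteness claims
    -- follow from this.
    have harea : Integrable (DeformedCylinder.fiberArea ω H ρ b u) b.measure := by
      refine (hLi.sub (hcurv.add hσ)).congr (Filter.Eventually.of_forall fun z => ?_)
      simp [hL]
    have hvertInt : (1 / 2) * ∫ z, DeformedCylinder.vertDensity H ρ J σ lam u z ∂b.measure =
        ∫ z, DeformedCylinder.fiberArea ω H ρ b u z ∂b.measure := by
      rw [integral_congr_ae hvert, integral_const_mul]
      ring
    have hEInt : ∫ z, DeformedCylinder.pullOmegaE ω H ρ b u z ∂b.measure =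
        (∫ z, DeformedCylinder.fiberArea ω H ρ b u z ∂b.measure)
          + ∫ z, DeformedCylinder.curvatureTerm H ρ u z ∂b.measure := by
      rw [hE, integral_add harea hcurv]
    have hLInt : ∫ z, DeformedCylinder.pullOmegaLam ω H ρ σ lam u z ∂b.measure =
        (∫ z, DeformedCylinder.fiberArea ω H ρ b u z ∂b.measure)
          + ∫ z, (DeformedCylinder.curvatureTerm H ρ u z + lam * σ.density z) ∂b.measure := by
      rw [hL]
      exact integral_add harea (hcurv.add hσ)
    refine ⟨(harea.const_mul 2).congr hvert.symm, hLi, hE ▸ harea.add hcurv, ?_, ?_,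
      fun hdec => ?_, fun hinc => ?_⟩
    · rw [hvertInt, hLInt, hhorInt, hcrossInt]
      ring
    · rw [hvertInt, hEInt]
      ring
    · have := hdec.neg_integral_iSup_le (H := H) hsub hAB hu'
      rw [hvertInt, hEInt]
      linarith
    · have := hinc.integral_iInf_le (H := H) hsub hAB hu'
      rw [hvertInt, hEInt, intervalIntegral.integral_neg]
      linarith
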